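/- Let $d\ge 1$, $0<\alpha\le 1$, $\beta>0$, and let $\lambda$ be Lebesgue measure on $\mathbb{R}^d$. Consider laws $P$ of $(X,Y)\in\mathbb{R}^d\times\{0,1\}$ with a regression function $\eta:\mathbb{R}^d\to[0,1]$, $\eta(x)=P(Y=1\mid X=x)$, let $\mathcal{X}$ be the support of $X$, and let $g(x)=1\{\eta(x)>1/2\}$ be the Bayes classifier. For positive constants $\kappa=(c_0,r_0,B,c_r,f_{\min},f_{\max})$ let $\mathcal{P}_{\alpha,\beta}(\kappa)$ be the class of all such $(P,\eta)$ satisfying - (B.1) $\lambda(\mathcal{X}\cap B(x,r))\ge c_0\,\lambda(B(x,r))$ for all $x\in\mathcal{X}$ and $0<r\le r_0$; - (B.2) $\mathcal{X}$ is compact; - (B.3) $P(0<|\eta(X)-1/2|<t)\le B t^{\beta}$ for all $t>0$; - (B.4) $|\eta(x+r)-\eta(x)|\le\|r\|^{\alpha}$ for all $x,r\in\mathbb{R}^d$ with $\|r\|\le c_r$; - (B.5) $X$ has a density $f$ with $f_{\min}\le f\le f_{\max}$ on $\mathcal{X}$; and let $\mathcal{P}_{\alpha,\beta}=\bigcup_\kappa\mathcal{P}_{\alpha,\beta}(\kappa)$.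 Let $\widehat g_n$ be any (measurable) classifier built from $n$ i.i.d. observations from $P$. It is applied to a perturbed version $\widetilde X$ of an independent test point $X$, where $(X,Y)\sim P$ and, for a level $\omega$, the perturbation is of one of two kinds: - random: given $X=x$, $\widetilde X$ is uniformly distributed on the sphere $\partial B(x,\omega)$, independently of everything else; - adversarial: given $X=x$, $\widetilde X$ is a minimiser of $\eta$ over the closed ball $B(x,\omega)$ if $\eta(x)>1/2$, and a maximiser of $\eta$ over it if $\eta(x)\le 1/2$; ties are broken by any measurable, possibly randomised, rule that may depend on $(P,\eta)$ but is independent of $Y$ given $X$ and of the training sample. Then there are a constant $C>0$ and positive constants $\kappa$, all depending only on $\alpha,\beta,d$, such that for every $n\ge1$, every $\omega\in[0,1]$, every classifier $\widehat g_n$, and either kind of perturbation (with any tie-breaking rule), $$\sup_{(P,\eta)\in\mathcal{P}_{\alpha,\beta}}\bigl[P(\widehat g_n(\widetilde X)\ne Y)-P(g(X)\ne Y)\bigr]\ \ge\ C\left(\omega^{\alpha(\beta+1)}\vee n^{-\frac{\alpha(\beta+1)}{2\alpha+d}}\right).$$ If moreover $\alpha\beta\le d$, the same bound, with the same $C$,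 holds with the supremum restricted to the class $\mathcal{P}_{\alpha,\beta}(\kappa)$ with these fixed constants. -/

import Mathlib

open MeasureTheory ProbabilityTheory

noncomputable section

namespace PerturbedClassification

/-- The feature space `ℝ^d` with its Euclidean norm. -/
abbrev Feature (d : ℕ) : Type := EuclideanSpace ℝ (Fin d)

/-- A labelled observation `(x, y)`; the label `1` is `true`, the label `0` is `false`. -/
abbrev Obs (d : ℕ) : Type := Feature d × Bool

/-- A law of `(X, Y)` together with a version of its regression function `η`. -/
abbrev Model (d : ℕ) : Type := Measure (Obs d) × (Feature d → ℝ)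

/-- `η(x) = P(Y = 1 | X = x)`, with values in `[0,1]`. -/
structure IsRegressionFunction {d : ℕ} (P : Measure (Obs d)) (η : Feature d → ℝ) : Prop where
  measurable : Measurable η
  nonneg : ∀ x, 0 ≤ η x
  le_one : ∀ x, η x ≤ 1
  setLIntegral_eq : ∀ A : Set (Feature d), MeasurableSet A →
    P (A ×ˢ {true}) = ∫⁻ x in A, ENNReal.ofReal (η x) ∂P.fst

/-- The constants that occur in the assumptions on the distribution: `c₀, r₀` (regularity of the
support), `B` (margin), `cr` (range of the smoothness condition), `fmin, fmax` (density). -/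
structure Constants where
  c₀ : ℝ
  r₀ : ℝ
  B : ℝ
  cr : ℝ
  fmin : ℝ
  fmax : ℝ
  c₀_pos : 0 < c₀
  r₀_pos : 0 < r₀
  B_pos : 0 < B
  cr_pos : 0 < cr
  fmin_pos : 0 < fmin
  fmax_pos : 0 < fmax

/-- The assumptions on the law `P` of `(X, Y)` and its regression function `η`, with smoothness
exponent `α`, margin exponent `β` and constants `κ`. The set `𝒳` is the support of `X`, and
`P.fst` is the law of `X`. -/
structure Satisfies {d : ℕ} (α β : ℝ) (κ : Constants) (P : Measure (Obs d))
    (η : Feature d → ℝ) : Prop where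
  isProbabilityMeasure : IsProbabilityMeasure P
  isRegressionFunction : IsRegressionFunction P η
  /-- `λ(𝒳 ∩ B(x,r)) ≥ c₀ λ(B(x,r))` for `x ∈ 𝒳` and `0 < r ≤ r₀`. -/
  regular : ∀ x ∈ P.fst.support, ∀ r : ℝ, 0 < r → r ≤ κ.r₀ →
    κ.c₀ * volume.real (Metric.ball x r) ≤ volume.real (P.fst.support ∩ Metric.ball x r)
  /-- The support of `X` is compact. -/
  compact : IsCompact P.fst.support
  /-- Margin condition: `P(0 < |η(X) - 1/2| < t) ≤ B t^β`. -/
  margin : ∀ t : ℝ, 0 < t →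
    P.fst.real {x | 0 < |η x - 1 / 2| ∧ |η x - 1 / 2| < t} ≤ κ.B * t ^ β
  /-- Smoothness: `|η(x + r) - η(x)| ≤ ‖r‖^α` for all `x` and all `‖r‖ ≤ cr`. -/
  smooth : ∀ x r : Feature d, ‖r‖ ≤ κ.cr → |η (x + r) - η x| ≤ ‖r‖ ^ α
  /-- `X` has a density, which lies between `fmin` and `fmax` on the support. -/
  density : ∃ f : Feature d → ℝ, Measurable f ∧
    P.fst = volume.withDensity (fun x => ENNReal.ofReal (f x)) ∧
    ∀ x ∈ P.fst.support, κ.fmin ≤ f x ∧ f x ≤ κ.fmax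

/-- The class of models that satisfy the assumptions with the given constants. -/
def distClassWith (d : ℕ) (α β : ℝ) (κ : Constants) : Set (Model d) :=
  {p | Satisfies α β κ p.1 p.2}

/-- The class `𝒫_{α,β}` of models that satisfy the assumptions with some constants. -/
def distClass (d : ℕ) (α β : ℝ) : Set (Model d) :=
  {p | ∃ κ : Constants, Satisfies α β κ p.1 p.2}

/-- The uniform distribution on the unit sphere of `ℝ^d` (normalised surface measure), as a
measure on `ℝ^d`. -/
def unifUnitSphere (d : ℕ) : Measure (Feature d) :=
  (((volume : Measure (Feature d)).toSphere Set.univ)⁻¹ •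
    (volume : Measure (Feature d)).toSphere).map Subtype.val

/-- Random perturbation: given `x`, the observed point is uniform on the sphere `∂B(x,ω)`, that
is, it is `x + ω u` with `u` uniform on the unit sphere. -/
def randomPerturbation (d : ℕ) (ω : ℝ) : Kernel (Feature d) (Feature d) :=
  (Kernel.id.prod (Kernel.const (Feature d) (unifUnitSphere d))).map (fun q => q.1 + ω • q.2)

/-- The points to which an adversary of strength `ω` may move `x`: the minimisers of `η` over the
closed ball `B(x,ω)` if `η(x) > 1/2`, and the maximisers otherwise. -/
def attackSet {d : ℕ} (ω : ℝ) (η : Feature d → ℝ) (x : Feature d) : Set (Feature d) :=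
  {z | z ∈ Metric.closedBall x ω ∧
    ((1 / 2 < η x ∧ ∀ w ∈ Metric.closedBall x ω, η z ≤ η w) ∨
      (η x ≤ 1 / 2 ∧ ∀ w ∈ Metric.closedBall x ω, η w ≤ η z))}

/-- Adversarial perturbation: given `x`, the observed point lies in `attackSet ω η x`; ties are
broken in an arbitrary measurable (possibly randomised) way. -/
def IsAttack {d : ℕ} (ω : ℝ) (η : Feature d → ℝ) (K : Kernel (Feature d) (Feature d)) : Prop :=
  IsMarkovKernel K ∧ ∀ x, K x (attackSet ω η x)ᶜ = 0

/-- A classifier built from `n` training observations: it maps the training sample and the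
observed test point to a label. -/
abbrev Classifier (d n : ℕ) : Type := (Fin n → Obs d) × Feature d → Bool

/-- `P(ĝ_n(X̃) ≠ Y)`: the training sample is i.i.d. from `P`, the test pair `(X, Y)` has law `P`
and is independent of it, and `X̃` is drawn from `K X`. -/
def testError {d n : ℕ} (P : Measure (Obs d)) (K : Kernel (Feature d) (Feature d))
    (g : Classifier d n) : ℝ :=
  ((Measure.pi (fun _ : Fin n => P)).prod (P ⊗ₘ K.prodMkRight Bool)).real
    {w | g (w.1, w.2.2) ≠ w.2.1.2}

open Classical in
/-- The Bayes classifier `g(x) = 1{η(x) > 1/2}`. -/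
def bayesClassifier {d : ℕ} (η : Feature d → ℝ) (x : Feature d) : Bool :=
  decide (1 / 2 < η x)

/-- `P(g(X) ≠ Y)` for the Bayes classifier `g`, at the unperturbed test point. -/
def bayesError {d : ℕ} (P : Measure (Obs d)) (η : Feature d → ℝ) : ℝ :=
  P.real {z | bayesClassifier η z.1 ≠ z.2}

/-- The worst-case regret `sup (P(ĝ_n(X̃) ≠ Y) - P(g(X) ≠ Y))` over a class of models, when the
test points of the model `p` are perturbed by the kernel `K p`. -/
def worstRegret {d n : ℕ} (𝒟 : Set (Model d))
    (K : Model d → Kernel (Feature d) (Feature d)) (g : Classifier d n) : ℝ :=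
  ⨆ p : 𝒟, (testError p.1.1 (K p.1) g - bayesError p.1.1 p.1.2)

/-- The rate `ω^{α(β+1)} ∨ n^{-α(β+1)/(2α+d)}`. -/
def rate (d : ℕ) (α β : ℝ) (n : ℕ) (ω : ℝ) : ℝ :=
  max (ω ^ (α * (β + 1))) ((n : ℝ) ^ (-(α * (β + 1) / (2 * α + d))))

end PerturbedClassification

end

/-! Both perturbations are harmful for a common reason. Where `η` is affine in one coordinate and
equals 1/2 on a hyperplane, the adversary moves a point straight towards that hyperplane, whichever
side carries the label 1. The uniform law on a sphere is symmetric, so it too can be written as a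
step towards the hyperplane. `PushesTowards` records this: on each side the law of the perturbed
point is the same whatever the sign of the slope.

The models live at a scale `s`. About `s⁻¹` sites per coordinate are placed at spacing `10 * d * s`,
each surrounded by `2 ^ d` cubes of side `s`, and `X` is uniform on all cubes. Around each active
site `η - 1/2` is, up to sign, a truncated linear function of size `s ^ α`; on the inactive cubes
`η` is exactly 1/2, which the margin condition ignores. The cubes avoid the hyperplane, so on the
active ones `|η - 1/2|` is at least of order `s ^ α`. Making a fraction about `s ^ (α * β)` of the
sites active satisfies the margin condition; an error of constant probability on the active cubes
then costs order `s ^ (α * (β + 1))`. Having at least one active site is what requires `α * β ≤ d`.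

Two scales are used. With `s = n ^ (-1 / (2α + d))` and `ω ≤ s`, the signs of the bumps cannot be
learned: a two-point bound through the affinity of product measures (`one_div_eight_le_test_errors`)
enters Assouad's averaging (`exists_le_excessRisk_of_hypercube`), and the perturbed point gives no
hint of the sign. For larger `ω`, take `s = ω` and a single model: `x` displaced by `-ω u` and `x -
2ω u` displaced by `ω u` coincide although their Bayes labels differ, so every classifier errs on
one of them, even knowing the law (`le_excessRisk_of_confusion`).

If `α * β > d`, the construction is run with `β₀ = d / α`. Since nonzero values of `|η - 1/2|` on
the support are bounded below, each model satisfies every margin condition with some constant, and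
the rate for `β₀` is the larger one. -/

noncomputable section

namespace PerturbedClassification

open scoped ENNReal Pointwise

/-! ### Product measures with densities -/

section ProductDensity

variable {Ω : Type*} [MeasurableSpace Ω]

/-- The integral of a tensor power is the power of the integral. -/
theorem lintegral_pi_prod_eq_pow (ν : Measure Ω) [SigmaFinite ν] {f : Ω → ℝ≥0∞}
    (hf : Measurable f) (n : ℕ) :
    ∫⁻ x, ∏ i, f (x i) ∂Measure.pi (fun _ : Fin n => ν) = (∫⁻ a, f a ∂ν) ^ n := by
  induction n with
  | zero => simp
  | succ n ih =>
    have h := (measurePreserving_piFinSuccAbove (fun _ : Fin (n + 1) => ν) 0).symm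
    rw [← h.lintegral_comp_emb (MeasurableEquiv.measurableEmbedding _)]
    have hprod : ∀ y : Ω × (Fin n → Ω),
        ∏ i, f ((MeasurableEquiv.piFinSuccAbove (fun _ : Fin (n + 1) => Ω) 0).symm y i)
          = f y.1 * ∏ i, f (y.2 i) := by
      intro y
      rw [Fin.prod_univ_succ]
      simp [MeasurableEquiv.piFinSuccAbove]
    simp_rw [hprod]
    have mf : Measurable fun x : Fin n → Ω => ∏ i, f (x i) := by fun_prop
    rw [lintegral_prod_mul (g := fun x : Fin n → Ω => ∏ i, f (x i)) hf.aemeasurable mf.aemeasurable,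
      ih, pow_succ']

/-- A power of a measure with density is the power of the measure with the product density. -/
theorem pi_withDensity (ν : Measure Ω) [SigmaFinite ν] {f : Ω → ℝ≥0∞} (hf : Measurable f)
    (n : ℕ) [SigmaFinite (ν.withDensity f)] :
    Measure.pi (fun _ : Fin n => ν.withDensity f)
      = (Measure.pi (fun _ : Fin n => ν)).withDensity (fun x => ∏ i, f (x i)) := by
  induction n with
  | zero =>
    rw [Measure.pi_of_empty _ default, Measure.pi_of_empty _ default]
    simp
  | succ n ih =>
    have h1 := (measurePreserving_piFinSuccAbove (fun _ : Fin (n + 1) => ν.withDensity f) 0).symm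
    have h := (measurePreserving_piFinSuccAbove (fun _ : Fin (n + 1) => ν) 0).symm
    rw [← h1.map_eq, ih, prod_withDensity hf (by fun_prop)]
    ext s hs
    rw [Measure.map_apply (MeasurableEquiv.measurable _) hs,
      withDensity_apply _ (MeasurableEquiv.measurable _ hs), withDensity_apply _ hs,
      ← h.setLIntegral_comp_preimage_emb (MeasurableEquiv.measurableEmbedding _)]
    refine setLIntegral_congr_fun (MeasurableEquiv.measurable _ hs) fun y _ => ?_
    rw [Fin.prod_univ_succ]
    simp [MeasurableEquiv.piFinSuccAbove]

/-- If `r² ≤ f q` for probability densities `f, q`, then the sum of the two errors of a test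
between the two product laws is bounded below in terms of the affinity `∫ r`. -/
theorem affinity_pow_le (ν : Measure Ω) [SigmaFinite ν] {f q r : Ω → ℝ≥0∞}
    (hf : Measurable f) (hq : Measurable q) (hr : Measurable r)
    [IsProbabilityMeasure (ν.withDensity f)] [IsProbabilityMeasure (ν.withDensity q)]
    (hrq : ∀ a, r a ^ 2 ≤ f a * q a) (n : ℕ) {S : Set (Fin n → Ω)} (hS : MeasurableSet S) :
    (∫⁻ a, r a ∂ν) ^ n ≤
      2 * (Measure.pi (fun _ : Fin n => ν.withDensity f) S
        + Measure.pi (fun _ : Fin n => ν.withDensity q) Sᶜ) + 4⁻¹ := by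
  -- Weighted AM-GM: `(2a + b/8)² ≥ 4 · 2a · b/8 = ab`. The small weight goes on the density whose
  -- integral is merely bounded by 1.
  have key : ∀ a b c : ℝ≥0∞, c ^ 2 ≤ a * b → c ≤ 2 * a + 8⁻¹ * b := by
    intro a b c h
    have h8 : (8 : ℝ≥0∞)⁻¹ ≠ 0 := by simp
    by_cases ha : a = ∞
    · simp [ha]
    by_cases hb : b = ∞
    · simp [hb, ENNReal.mul_top h8]
    have hc : c ≠ ∞ := by
      rintro rfl
      have := ENNReal.mul_lt_top (lt_top_iff_ne_top.2 ha) (lt_top_iff_ne_top.2 hb)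
      simp at h
      exact this.ne h
    lift a to NNReal using ha
    lift b to NNReal using hb
    lift c to NNReal using hc
    have h' : c ^ 2 ≤ a * b := by exact_mod_cast h
    have e8 : (8 : ℝ≥0∞)⁻¹ = ((8⁻¹ : NNReal) : ℝ≥0∞) := by
      rw [ENNReal.coe_inv (by norm_num)]; norm_num
    rw [e8]
    have : c ≤ 2 * a + 8⁻¹ * b := by
      have h2 : (c : ℝ) ^ 2 ≤ a * b := by exact_mod_cast h'
      have : (c : ℝ) ≤ 2 * a + 8⁻¹ * b := by
        have ha0 := a.coe_nonneg
        have hb0 := b.coe_nonneg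
        refine (sq_le_sq₀ c.coe_nonneg (by positivity)).1 ?_
        nlinarith [sq_nonneg (2 * (a : ℝ) - 8⁻¹ * b)]
      exact_mod_cast this
    exact_mod_cast this
  have hF : ∀ x : Fin n → Ω, (∏ i, r (x i)) ^ 2 ≤ (∏ i, f (x i)) * ∏ i, q (x i) := by
    intro x
    rw [← Finset.prod_pow, ← Finset.prod_mul_distrib]
    exact Finset.prod_le_prod' fun i _ => hrq _
  have hP : ∀ T : Set (Fin n → Ω), MeasurableSet T →
      Measure.pi (fun _ : Fin n => ν.withDensity f) T
        = ∫⁻ x in T, ∏ i, f (x i) ∂Measure.pi (fun _ : Fin n => ν) := fun T hT => by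
    rw [pi_withDensity ν hf, withDensity_apply _ hT]
  have hQ : ∀ T : Set (Fin n → Ω), MeasurableSet T →
      Measure.pi (fun _ : Fin n => ν.withDensity q) T
        = ∫⁻ x in T, ∏ i, q (x i) ∂Measure.pi (fun _ : Fin n => ν) := fun T hT => by
    rw [pi_withDensity ν hq, withDensity_apply _ hT]
  have mf : Measurable fun x : Fin n → Ω => ∏ i, f (x i) := by fun_prop
  have mq : Measurable fun x : Fin n → Ω => ∏ i, q (x i) := by fun_prop
  have h1 : ∫⁻ x in S, ∏ i, r (x i) ∂Measure.pi (fun _ : Fin n => ν)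
      ≤ 2 * Measure.pi (fun _ : Fin n => ν.withDensity f) S + 8⁻¹ := by
    calc _ ≤ ∫⁻ x in S, (2 * ∏ i, f (x i) + 8⁻¹ * ∏ i, q (x i))
          ∂Measure.pi (fun _ : Fin n => ν) := lintegral_mono fun x => key _ _ _ (hF x)
      _ = 2 * Measure.pi (fun _ : Fin n => ν.withDensity f) S
          + 8⁻¹ * Measure.pi (fun _ : Fin n => ν.withDensity q) S := by
        rw [lintegral_add_left (by fun_prop), lintegral_const_mul _ mf, lintegral_const_mul _ mq,
          hP S hS, hQ S hS]
      _ ≤ _ := by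
        gcongr
        exact mul_le_of_le_one_right' prob_le_one
  -- The two densities exchange roles on the complement; the two remainders add up to `1/4`.
  have h2 : ∫⁻ x in Sᶜ, ∏ i, r (x i) ∂Measure.pi (fun _ : Fin n => ν)
      ≤ 2 * Measure.pi (fun _ : Fin n => ν.withDensity q) Sᶜ + 8⁻¹ := by
    calc _ ≤ ∫⁻ x in Sᶜ, (2 * ∏ i, q (x i) + 8⁻¹ * ∏ i, f (x i))
          ∂Measure.pi (fun _ : Fin n => ν) :=
          lintegral_mono fun x => key _ _ _ ((hF x).trans_eq (mul_comm _ _))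
      _ = 2 * Measure.pi (fun _ : Fin n => ν.withDensity q) Sᶜ
          + 8⁻¹ * Measure.pi (fun _ : Fin n => ν.withDensity f) Sᶜ := by
        rw [lintegral_add_left (by fun_prop), lintegral_const_mul _ mf, lintegral_const_mul _ mq,
          hP _ hS.compl, hQ _ hS.compl]
      _ ≤ _ := by
        gcongr
        exact mul_le_of_le_one_right' prob_le_one
  have h48 : (8 : ℝ≥0∞)⁻¹ + 8⁻¹ = 4⁻¹ := by
    rw [← two_mul, show (8 : ℝ≥0∞) = 2 * 4 by norm_num,
      ENNReal.mul_inv (by simp) (by simp), ← mul_assoc, ENNReal.mul_inv_cancel (by simp) (by simp),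
      one_mul]
  rw [← lintegral_pi_prod_eq_pow ν hr, ← lintegral_add_compl _ hS]
  calc _ ≤ _ := add_le_add h1 h2
    _ = _ := by rw [← h48]; ring

end ProductDensity

/-! ### The law of a labelled observation with given marginal and regression function -/

section LabelledLaw

variable {d : ℕ}

/-- The density, with respect to the product of the law of `X` and the counting measure, of the
law of `(X, Y)` with regression function `η`. -/
def labelDensity (η : Feature d → ℝ) (z : Obs d) : ℝ≥0∞ :=
  if z.2 then ENNReal.ofReal (η z.1) else ENNReal.ofReal (1 - η z.1)

/-- The law of `(X, Y)` when `X` has law `μ` and `P(Y = 1 | X = x) = η(x)`. -/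
def labelledLaw (μ : Measure (Feature d)) (η : Feature d → ℝ) : Measure (Obs d) :=
  (μ.prod Measure.count).withDensity (labelDensity η)

theorem measurable_labelDensity {η : Feature d → ℝ} (hη : Measurable η) :
    Measurable (labelDensity η) := by
  unfold labelDensity
  refine Measurable.ite (measurable_snd (measurableSet_singleton true)) ?_ ?_ <;> fun_prop

theorem lintegral_prod_count_bool (μ : Measure (Feature d)) [SFinite μ] {F : Obs d → ℝ≥0∞}
    (hF : Measurable F) :
    ∫⁻ z, F z ∂(μ.prod Measure.count) = ∫⁻ x, (F (x, true) + F (x, false)) ∂μ := by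
  rw [lintegral_prod _ hF.aemeasurable]
  refine lintegral_congr fun x => ?_
  rw [lintegral_count, tsum_fintype, Fintype.sum_bool]

theorem lintegral_labelledLaw (μ : Measure (Feature d)) [SFinite μ] {η : Feature d → ℝ}
    (hη : Measurable η) {F : Obs d → ℝ≥0∞} (hF : Measurable F) :
    ∫⁻ z, F z ∂labelledLaw μ η = ∫⁻ x, (ENNReal.ofReal (η x) * F (x, true)
      + ENNReal.ofReal (1 - η x) * F (x, false)) ∂μ := by
  rw [labelledLaw, lintegral_withDensity_eq_lintegral_mul _ (measurable_labelDensity hη) hF,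
    lintegral_prod_count_bool μ ((measurable_labelDensity hη).mul hF)]
  simp [labelDensity]

theorem labelledLaw_apply (μ : Measure (Feature d)) [SFinite μ] {η : Feature d → ℝ}
    (hη : Measurable η) {S : Set (Obs d)} (hS : MeasurableSet S) :
    labelledLaw μ η S = ∫⁻ x, (ENNReal.ofReal (η x) * S.indicator 1 (x, true)
      + ENNReal.ofReal (1 - η x) * S.indicator 1 (x, false)) ∂μ := by
  rw [← lintegral_labelledLaw μ hη (measurable_one.indicator hS), lintegral_indicator_one hS]

theorem ofReal_add_ofReal_one_sub {t : ℝ} (h0 : 0 ≤ t) (h1 : t ≤ 1) :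
    ENNReal.ofReal t + ENNReal.ofReal (1 - t) = 1 := by
  rw [← ENNReal.ofReal_add h0 (by linarith)]
  simp

theorem fst_labelledLaw (μ : Measure (Feature d)) [SFinite μ] {η : Feature d → ℝ}
    (hη : Measurable η) (h0 : ∀ x, 0 ≤ η x) (h1 : ∀ x, η x ≤ 1) :
    (labelledLaw μ η).fst = μ := by
  ext A hA
  rw [Measure.fst_apply hA, labelledLaw_apply μ hη (measurable_fst hA), ← lintegral_indicator_one hA]
  refine lintegral_congr fun x => ?_
  by_cases hx : x ∈ A <;> simp [hx, ofReal_add_ofReal_one_sub (h0 x) (h1 x)]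

theorem isProbabilityMeasure_labelledLaw (μ : Measure (Feature d)) [IsProbabilityMeasure μ]
    {η : Feature d → ℝ} (hη : Measurable η) (h0 : ∀ x, 0 ≤ η x) (h1 : ∀ x, η x ≤ 1) :
    IsProbabilityMeasure (labelledLaw μ η) := by
  constructor
  rw [← Measure.fst_univ, fst_labelledLaw μ hη h0 h1, measure_univ]

theorem isRegressionFunction_labelledLaw (μ : Measure (Feature d)) [SFinite μ]
    {η : Feature d → ℝ} (hη : Measurable η) (h0 : ∀ x, 0 ≤ η x) (h1 : ∀ x, η x ≤ 1) :
    IsRegressionFunction (labelledLaw μ η) η where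
  measurable := hη
  nonneg := h0
  le_one := h1
  setLIntegral_eq A hA := by
    rw [fst_labelledLaw μ hη h0 h1,
      labelledLaw_apply μ hη (hA.prod (measurableSet_singleton true)), ← lintegral_indicator hA]
    refine lintegral_congr fun x => ?_
    by_cases hx : x ∈ A <;> simp [hx]

/-- A test based on `n` observations cannot tell two regression functions apart that differ only
on a set of small mass, where they are close to `1/2` and symmetric about it. -/
theorem one_div_eight_le_test_errors (μ : Measure (Feature d)) [IsProbabilityMeasure μ]
    {η η' : Feature d → ℝ} (hη : Measurable η) (h0 : ∀ x, 0 ≤ η x) (h1 : ∀ x, η x ≤ 1)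
    (hη' : Measurable η') (h0' : ∀ x, 0 ≤ η' x) (h1' : ∀ x, η' x ≤ 1)
    {U : Set (Feature d)} (hU : MeasurableSet U) (hout : ∀ x ∉ U, η x = η' x)
    (hsum : ∀ x ∈ U, η x + η' x = 1) {a : ℝ} (ha : ∀ x ∈ U, |η x - 1 / 2| ≤ a)
    (ha2 : a ≤ 1 / 2) (ha0 : 0 ≤ a)
    {n : ℕ} (hn : n * (4 * a ^ 2 * μ.real U) ≤ 1 / 2)
    {S : Set (Fin n → Obs d)} (hS : MeasurableSet S) :
    8⁻¹ ≤ Measure.pi (fun _ : Fin n => labelledLaw μ η) S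
      + Measure.pi (fun _ : Fin n => labelledLaw μ η') Sᶜ := by
  classical
  have hP := isProbabilityMeasure_labelledLaw μ hη h0 h1
  have hP' := isProbabilityMeasure_labelledLaw μ hη' h0' h1'
  set b : ℝ := 4 * a ^ 2 with hb
  have hb1 : b ≤ 1 := by nlinarith
  have hb0 : 0 ≤ b := by positivity
  -- A minorant of the geometric mean of the two densities, without square roots: on `U` their
  -- product is `1/4 - (η - 1/2)² ≥ (1 - b)/4 ≥ ((1 - b)/2)²`. Its integral is `1 - b μ(U)`.
  let r : Obs d → ℝ≥0∞ := fun z =>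
    if z.1 ∈ U then ENNReal.ofReal ((1 - b) / 2) else labelDensity η z
  have mr : Measurable r :=
    Measurable.ite (measurable_fst hU) measurable_const (measurable_labelDensity hη)
  have hr : ∀ z, r z ^ 2 ≤ labelDensity η z * labelDensity η' z := by
    rintro ⟨x, y⟩
    by_cases hx : x ∈ U
    · have e : η' x = 1 - η x := by linarith [hsum x hx]
      have key : ENNReal.ofReal ((1 - b) / 2) ^ 2
          ≤ ENNReal.ofReal (η x) * ENNReal.ofReal (1 - η x) := by
        rw [← ENNReal.ofReal_pow (by linarith), ← ENNReal.ofReal_mul (h0 x)]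
        apply ENNReal.ofReal_le_ofReal
        have h2 : (η x - 1 / 2) ^ 2 ≤ a ^ 2 := sq_le_sq' (abs_le.1 (ha x hx)).1 (abs_le.1 (ha x hx)).2
        nlinarith
      cases y
      · simpa [r, hx, labelDensity, e, mul_comm] using key
      · simpa [r, hx, labelDensity, e] using key
    · have e := hout x hx
      cases y <;> simp [r, hx, labelDensity, e, sq]
  rw [labelledLaw] at hP hP'
  have haff := affinity_pow_le (μ.prod Measure.count) (measurable_labelDensity hη)
    (measurable_labelDensity hη') mr hr n hS
  have hint : ENNReal.ofReal (1 - b * μ.real U) ≤ ∫⁻ z, r z ∂(μ.prod Measure.count) := by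
    rw [lintegral_prod_count_bool μ mr]
    have hpt : ∀ x, r (x, true) + r (x, false)
        = U.indicator (fun _ => ENNReal.ofReal (1 - b)) x + Uᶜ.indicator 1 x := by
      intro x
      by_cases hx : x ∈ U
      · simp only [r, hx, if_true, Set.indicator_of_mem, Set.mem_compl_iff, not_true,
          not_false_eq_true, Set.indicator_of_notMem, add_zero]
        rw [← ENNReal.ofReal_add (by linarith) (by linarith)]
        congr 1; ring
      · simp [r, hx, labelDensity, ofReal_add_ofReal_one_sub (h0 x) (h1 x)]
    simp_rw [hpt]
    rw [lintegral_add_left (measurable_const.indicator hU), lintegral_indicator_const hU,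
      lintegral_indicator_one hU.compl, ← ofReal_measureReal (s := U),
      ← ofReal_measureReal (s := Uᶜ), ← ENNReal.ofReal_mul (by linarith),
      ← ENNReal.ofReal_add (mul_nonneg (by linarith) measureReal_nonneg) measureReal_nonneg]
    apply ENNReal.ofReal_le_ofReal
    rw [probReal_compl_eq_one_sub hU]
    linarith
  have hw1 : μ.real U ≤ 1 := measureReal_le_one
  have hw0 : 0 ≤ μ.real U := measureReal_nonneg
  -- Bernoulli's inequality and `hn` keep the affinity of the samples above `1/2`, so twice the sum
  -- of errors is at least `1/2 - 1/4`.
  have hbern : ENNReal.ofReal (1 / 2) ≤ (∫⁻ z, r z ∂(μ.prod Measure.count)) ^ n := by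
    calc ENNReal.ofReal (1 / 2) ≤ ENNReal.ofReal ((1 - b * μ.real U) ^ n) := by
          apply ENNReal.ofReal_le_ofReal
          have := one_add_mul_le_pow (a := -(b * μ.real U)) (by nlinarith) n
          have e : (1 : ℝ) - b * μ.real U = 1 + -(b * μ.real U) := by ring
          rw [e]
          linarith
      _ = ENNReal.ofReal (1 - b * μ.real U) ^ n := ENNReal.ofReal_pow (by nlinarith) n
      _ ≤ _ := by gcongr
  have hfin := hbern.trans haff
  rw [labelledLaw, labelledLaw]
  generalize hE : Measure.pi (fun _ : Fin n => (μ.prod Measure.count).withDensity (labelDensity η)) S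
      + Measure.pi (fun _ : Fin n => (μ.prod Measure.count).withDensity (labelDensity η')) Sᶜ = e
    at hfin ⊢
  by_cases he : e = ∞
  · simp [he]
  lift e to NNReal using he
  have e4 : (4 : ℝ≥0∞)⁻¹ = ENNReal.ofReal (1 / 4) := by
    rw [one_div, ENNReal.ofReal_inv_of_pos (by norm_num)]; norm_num
  have e8 : (8 : ℝ≥0∞)⁻¹ = ENNReal.ofReal (1 / 8) := by
    rw [one_div, ENNReal.ofReal_inv_of_pos (by norm_num)]; norm_num
  have e2 : (2 : ℝ≥0∞) = ENNReal.ofReal 2 := by norm_num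
  rw [e4, e2, ← ENNReal.ofReal_coe_nnreal, ← ENNReal.ofReal_mul (by norm_num),
    ← ENNReal.ofReal_add (by positivity) (by norm_num),
    ENNReal.ofReal_le_ofReal_iff (by positivity)] at hfin
  rw [e8, ← ENNReal.ofReal_coe_nnreal]
  apply ENNReal.ofReal_le_ofReal
  linarith

end LabelledLaw

/-! ### The excess risk -/

section ExcessRisk

variable {d n : ℕ}

/-- The probability, over the training sample (with law `ρ`) and the perturbation of `x`, that the
classifier does not output the label `y`. -/
def missProb (ρ : Measure (Fin n → Obs d)) (K : Kernel (Feature d) (Feature d))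
    (g : Classifier d n) (x : Feature d) (y : Bool) : ℝ≥0∞ :=
  ∫⁻ z, ρ {D | g (D, z) ≠ y} ∂K x

/-- The excess risk `E[|2η(X) - 1| 1{ĝ_n(X̃) ≠ g(X)}]`. -/
def excessRisk (μ : Measure (Feature d)) (η : Feature d → ℝ)
    (K : Kernel (Feature d) (Feature d)) (g : Classifier d n) : ℝ≥0∞ :=
  ∫⁻ x, ENNReal.ofReal |2 * η x - 1| *
    missProb (Measure.pi fun _ : Fin n => labelledLaw μ η) K g x (bayesClassifier η x) ∂μ

variable {g : Classifier d n}

theorem measurableSet_classifier_ne (hg : Measurable g) (z : Feature d) (y : Bool) :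
    MeasurableSet {D | g (D, z) ≠ y} :=
  (hg.comp measurable_prodMk_right) (measurableSet_singleton y).compl

theorem measurable_measure_classifier_ne (hg : Measurable g) (ρ : Measure (Fin n → Obs d))
    [SFinite ρ] (y : Bool) : Measurable fun z => ρ {D | g (D, z) ≠ y} :=
  measurable_measure_prodMk_right (s := {w | g w ≠ y}) (hg (measurableSet_singleton y).compl)

theorem measurable_missProb (hg : Measurable g) (ρ : Measure (Fin n → Obs d)) [SFinite ρ]
    (K : Kernel (Feature d) (Feature d)) (y : Bool) :
    Measurable fun x => missProb ρ K g x y :=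
  (measurable_measure_classifier_ne hg ρ y).lintegral_kernel

theorem missProb_true_add_false (hg : Measurable g) (ρ : Measure (Fin n → Obs d))
    [IsProbabilityMeasure ρ] (K : Kernel (Feature d) (Feature d)) [IsMarkovKernel K]
    (x : Feature d) : missProb ρ K g x true + missProb ρ K g x false = 1 := by
  unfold missProb
  rw [← lintegral_add_left (measurable_measure_classifier_ne hg ρ true)]
  have : ∀ z, ρ {D | g (D, z) ≠ true} + ρ {D | g (D, z) ≠ false} = 1 := by
    intro z
    have e : {D | g (D, z) ≠ false} = {D | g (D, z) ≠ true}ᶜ := by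
      ext D; simp
    rw [e, measure_add_measure_compl (measurableSet_classifier_ne hg z true), measure_univ]
  rw [lintegral_congr this, lintegral_one, measure_univ]

theorem measurable_bayesClassifier {η : Feature d → ℝ} (hη : Measurable η) :
    Measurable (bayesClassifier η) := by
  refine measurable_to_bool ?_
  have : bayesClassifier η ⁻¹' {true} = {x | 1 / 2 < η x} := by
    ext x; simp [bayesClassifier]
  rw [this]
  exact measurableSet_lt measurable_const hη

/-- The regret of a classifier is its excess risk. -/
theorem testError_sub_bayesError (μ : Measure (Feature d)) [IsProbabilityMeasure μ]
    {η : Feature d → ℝ} (hη : Measurable η) (h0 : ∀ x, 0 ≤ η x) (h1 : ∀ x, η x ≤ 1)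
    (K : Kernel (Feature d) (Feature d)) [IsMarkovKernel K] (hg : Measurable g) :
    testError (labelledLaw μ η) K g - bayesError (labelledLaw μ η) η
      = (excessRisk μ η K g).toReal := by
  have hP := isProbabilityMeasure_labelledLaw μ hη h0 h1
  set ρ := Measure.pi fun _ : Fin n => labelledLaw μ η with hρ
  have hmb := measurable_bayesClassifier hη
  have hset : MeasurableSet {w : (Fin n → Obs d) × Obs d × Feature d | g (w.1, w.2.2) ≠ w.2.1.2} :=
    (measurableSet_eq_fun (hg.comp (by fun_prop)) (by fun_prop)).compl
  have hT : (ρ.prod (labelledLaw μ η ⊗ₘ K.prodMkRight Bool))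
      {w | g (w.1, w.2.2) ≠ w.2.1.2}
      = ∫⁻ x, (ENNReal.ofReal (η x) * missProb ρ K g x true
        + ENNReal.ofReal (1 - η x) * missProb ρ K g x false) ∂μ := by
    rw [Measure.prod_apply_symm hset, Measure.lintegral_compProd (measurable_measure_prodMk_right hset)]
    rw [lintegral_labelledLaw μ hη (Measurable.lintegral_kernel_prod_right'
      (κ := K.prodMkRight Bool) (measurable_measure_prodMk_right hset))]
    -- `K.prodMkRight Bool` ignores the label, so both inner integrals are `missProb` by definition.
    rfl
  have hB : labelledLaw μ η {z | bayesClassifier η z.1 ≠ z.2}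
      = ∫⁻ x, ENNReal.ofReal (min (η x) (1 - η x)) ∂μ := by
    have hne : MeasurableSet {z : Obs d | bayesClassifier η z.1 ≠ z.2} :=
      (measurableSet_eq_fun (hmb.comp measurable_fst) measurable_snd).compl
    rw [labelledLaw_apply μ hη hne]
    refine lintegral_congr fun x => ?_
    by_cases hx : 1 / 2 < η x
    · have e : bayesClassifier η x = true := by simpa [bayesClassifier] using hx
      rw [min_eq_right (by linarith)]
      simp [Set.indicator, e]
    · have e : bayesClassifier η x = false := by simpa [bayesClassifier] using hx
      rw [min_eq_left (by linarith)]
      simp [Set.indicator, e]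
  -- The two miss probabilities sum to 1. The smaller of `η`, `1 - η` therefore contributes the
  -- Bayes error, and the surplus `|2η - 1|` of the larger one multiplies the probability of missing
  -- the Bayes label.
  have hsplit : ∫⁻ x, (ENNReal.ofReal (η x) * missProb ρ K g x true
        + ENNReal.ofReal (1 - η x) * missProb ρ K g x false) ∂μ
      = ∫⁻ x, ENNReal.ofReal (min (η x) (1 - η x)) ∂μ + excessRisk μ η K g := by
    have hmin : Measurable fun x => ENNReal.ofReal (min (η x) (1 - η x)) :=
      (hη.min (measurable_const.sub hη)).ennreal_ofReal
    rw [excessRisk, ← hρ, ← lintegral_add_left hmin]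
    refine lintegral_congr fun x => ?_
    have hm := missProb_true_add_false hg ρ K x
    by_cases hx : 1 / 2 < η x
    · have e : bayesClassifier η x = true := by simpa [bayesClassifier] using hx
      rw [min_eq_right (by linarith), e, abs_of_pos (by linarith)]
      have e1 : ENNReal.ofReal (η x)
          = ENNReal.ofReal (1 - η x) + ENNReal.ofReal (2 * η x - 1) := by
        rw [← ENNReal.ofReal_add (by linarith [h1 x]) (by linarith)]
        congr 1; ring
      rw [e1, add_mul, add_right_comm, ← mul_add, hm, mul_one]
    · have e : bayesClassifier η x = false := by simpa [bayesClassifier] using hx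
      rw [min_eq_left (by linarith), e, abs_of_nonpos (by linarith)]
      have e1 : ENNReal.ofReal (1 - η x)
          = ENNReal.ofReal (η x) + ENNReal.ofReal (-(2 * η x - 1)) := by
        rw [← ENNReal.ofReal_add (h0 x) (by linarith)]
        congr 1; ring
      rw [e1, add_mul, ← add_assoc, ← mul_add, hm, mul_one]
  rw [testError, bayesError, measureReal_def, measureReal_def, hB, ← hρ, hT, hsplit]
  have hfin : ∫⁻ x, ENNReal.ofReal (min (η x) (1 - η x)) ∂μ + excessRisk μ η K g ≠ ∞ := by
    rw [← hsplit, ← hT]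
    exact measure_ne_top _ _
  rw [ENNReal.toReal_add (ne_top_of_le_ne_top hfin le_self_add)
    (ne_top_of_le_ne_top hfin le_add_self)]
  ring

end ExcessRisk

/-! ### Lower bounds for the excess risk -/

section LowerBounds

variable {d n : ℕ} {ι : Type*}

/-- Puts the risks of two models with opposite Bayes labels in the form of an event and its
complement, the two errors of one test. -/
theorem missProb_not (ρ : Measure (Fin n → Obs d)) (K : Kernel (Feature d) (Feature d))
    (g : Classifier d n) (x : Feature d) (y : Bool) :
    missProb ρ K g x (!y) = ∫⁻ z, ρ {D | g (D, z) ≠ y}ᶜ ∂K x := by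
  unfold missProb
  refine lintegral_congr fun z => ?_
  congr 1
  ext D
  cases y <;> simp

theorem measurable_missProb_comp {g : Classifier d n} (hg : Measurable g)
    (ρ : Measure (Fin n → Obs d)) [SFinite ρ] (K : Kernel (Feature d) (Feature d))
    {f : Feature d → Bool} (hf : Measurable f) :
    Measurable fun x => missProb ρ K g x (f x) := by
  have e : (fun x => missProb ρ K g x (f x))
      = fun x => if f x = true then missProb ρ K g x true else missProb ρ K g x false := by
    funext x
    cases f x <;> rfl
  rw [e]
  exact Measurable.ite (hf (measurableSet_singleton true)) (measurable_missProb hg ρ K true)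
    (measurable_missProb hg ρ K false)

theorem sum_setLIntegral_missProb_le_excessRisk (μ : Measure (Feature d)) [IsProbabilityMeasure μ]
    {η : Feature d → ℝ} (K : Kernel (Feature d) (Feature d))
    {g : Classifier d n} (J : Finset ι) {Q : ι → Set (Feature d)}
    (hQ : ∀ k, MeasurableSet (Q k)) (hdisj : Set.PairwiseDisjoint (↑J) Q) {b : ℝ}
    (hb : ∀ k ∈ J, ∀ x ∈ Q k, b ≤ |2 * η x - 1|) :
    ∑ k ∈ J, ENNReal.ofReal b * ∫⁻ x in Q k,
        missProb (Measure.pi fun _ : Fin n => labelledLaw μ η) K g x (bayesClassifier η x) ∂μ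
      ≤ excessRisk μ η K g := by
  calc _ ≤ ∑ k ∈ J, ∫⁻ x in Q k, ENNReal.ofReal |2 * η x - 1| *
        missProb (Measure.pi fun _ : Fin n => labelledLaw μ η) K g x (bayesClassifier η x) ∂μ := by
        refine Finset.sum_le_sum fun k hk => ?_
        rw [← lintegral_const_mul' _ _ ENNReal.ofReal_ne_top]
        refine setLIntegral_mono' (hQ k) fun x hx => ?_
        gcongr
        exact hb k hk x hx
    _ = ∫⁻ x in ⋃ k ∈ J, Q k, ENNReal.ofReal |2 * η x - 1| *
        missProb (Measure.pi fun _ : Fin n => labelledLaw μ η) K g x (bayesClassifier η x) ∂μ :=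
        (lintegral_biUnion_finset hdisj (fun k _ => hQ k) _).symm
    _ ≤ _ := setLIntegral_le_lintegral _ _

theorem bayesClassifier_eq_not_of_add_eq_one {η η' : Feature d → ℝ} {x : Feature d}
    (h : η x + η' x = 1) (hne : 0 < |2 * η x - 1|) :
    bayesClassifier η' x = !bayesClassifier η x := by
  have h2 : 2 * η x - 1 ≠ 0 := abs_pos.1 hne
  by_cases hx : 1 / 2 < η x
  · have : ¬ 1 / 2 < η' x := by linarith
    simp only [bayesClassifier, hx, this, decide_true, decide_false, Bool.not_true]
  · have h3 : η x ≠ 1 / 2 := fun h => h2 (by linarith)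
    have : 1 / 2 < η' x := by linarith [lt_of_le_of_ne (not_lt.1 hx) h3]
    simp only [bayesClassifier, hx, this, decide_true, decide_false, Bool.not_false]

/-- Assouad's lemma: in a hypercube of models, indexed by the signs of `η - 1/2` on the cells
`U k`, where the law of the perturbed test point does not reveal the sign, any classifier has
a large excess risk under some model. -/
theorem exists_le_excessRisk_of_hypercube [Fintype ι] [DecidableEq ι]
    (μ : Measure (Feature d)) [IsProbabilityMeasure μ]
    {η : (ι → Bool) → Feature d → ℝ} (hη : ∀ σ, Measurable (η σ)) (h0 : ∀ σ x, 0 ≤ η σ x)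
    (h1 : ∀ σ x, η σ x ≤ 1) (K : (ι → Bool) → Kernel (Feature d) (Feature d))
    [∀ σ, IsMarkovKernel (K σ)] {g : Classifier d n} (hg : Measurable g)
    (J : Finset ι) {U Q : ι → Set (Feature d)} (hU : ∀ k, MeasurableSet (U k))
    (hQ : ∀ k, MeasurableSet (Q k)) (hdisj : Set.PairwiseDisjoint (↑J) Q)
    (hQU : ∀ k, Q k ⊆ U k)
    (hout : ∀ σ, ∀ k ∈ J, ∀ x ∉ U k, η σ x = η (Function.update σ k (!σ k)) x)
    (hsum : ∀ σ, ∀ k ∈ J, ∀ x ∈ U k, η σ x + η (Function.update σ k (!σ k)) x = 1)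
    {a : ℝ} (ha0 : 0 ≤ a) (ha2 : a ≤ 1 / 2)
    (ha : ∀ σ, ∀ k ∈ J, ∀ x ∈ U k, |η σ x - 1 / 2| ≤ a)
    (hn : ∀ k ∈ J, n * (4 * a ^ 2 * μ.real (U k)) ≤ 1 / 2)
    {b : ℝ} (hb0 : 0 < b) (hb : ∀ σ, ∀ k ∈ J, ∀ x ∈ Q k, b ≤ |2 * η σ x - 1|)
    (hK : ∀ σ, ∀ k ∈ J, ∀ x ∈ Q k, K σ x = K (Function.update σ k (!σ k)) x)
    {w : ℝ≥0∞} (hw : ∀ k ∈ J, w ≤ μ (Q k)) :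
    ∃ σ, (J.card : ℝ≥0∞) * (ENNReal.ofReal b * (8⁻¹ * w)) ≤ 2 * excessRisk μ (η σ) (K σ) g := by
  have hP := fun σ => isProbabilityMeasure_labelledLaw μ (hη σ) (h0 σ) (h1 σ)
  let flip : ι → (ι → Bool) → (ι → Bool) := fun k σ => Function.update σ k (!σ k)
  have hflip : ∀ k, Function.Involutive (flip k) := by
    intro k σ
    simp [flip]
  let G : (ι → Bool) → ι → ℝ≥0∞ := fun σ k => ENNReal.ofReal b * ∫⁻ x in Q k,
    missProb (Measure.pi fun _ : Fin n => labelledLaw μ (η σ)) (K σ) g x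
      (bayesClassifier (η σ) x) ∂μ
  have hGle : ∀ σ, ∑ k ∈ J, G σ k ≤ excessRisk μ (η σ) (K σ) g := fun σ =>
    sum_setLIntegral_missProb_le_excessRisk μ (K σ) J hQ hdisj (hb σ)
  have hpair : ∀ σ, ∀ k ∈ J, ENNReal.ofReal b * (8⁻¹ * w) ≤ G σ k + G (flip k σ) k := by
    intro σ k hk
    have hpt : ∀ x ∈ Q k, 8⁻¹ ≤
        missProb (Measure.pi fun _ : Fin n => labelledLaw μ (η σ)) (K σ) g x
          (bayesClassifier (η σ) x)
        + missProb (Measure.pi fun _ : Fin n => labelledLaw μ (η (flip k σ))) (K (flip k σ)) g x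
          (bayesClassifier (η (flip k σ)) x) := by
      -- The Bayes labels are opposite and the perturbed points have the same law `K σ x`, so for
      -- each fixed observed point `z` the classifier is a test between the two sample laws.
      intro x hx
      rw [bayesClassifier_eq_not_of_add_eq_one (hsum σ k hk x (hQU k hx))
        (hb0.trans_le (hb σ k hk x hx)), missProb_not, missProb, ← hK σ k hk x hx,
        ← lintegral_add_left (measurable_measure_classifier_ne hg _ _)]
      calc (8 : ℝ≥0∞)⁻¹ = ∫⁻ _, 8⁻¹ ∂K σ x := by simp
        _ ≤ _ := lintegral_mono fun z =>
          one_div_eight_le_test_errors μ (hη σ) (h0 σ) (h1 σ) (hη _) (h0 _) (h1 _) (hU k)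
            (hout σ k hk) (hsum σ k hk) (ha σ k hk) ha2 ha0 (hn k hk)
            (measurableSet_classifier_ne hg z _)
    calc ENNReal.ofReal b * (8⁻¹ * w) ≤ ENNReal.ofReal b * ∫⁻ _ in Q k, 8⁻¹ ∂μ := by
          rw [setLIntegral_const]
          gcongr
          exact hw k hk
      _ ≤ ENNReal.ofReal b * ∫⁻ x in Q k,
          (missProb (Measure.pi fun _ : Fin n => labelledLaw μ (η σ)) (K σ) g x
            (bayesClassifier (η σ) x)
          + missProb (Measure.pi fun _ : Fin n => labelledLaw μ (η (flip k σ))) (K (flip k σ)) g x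
            (bayesClassifier (η (flip k σ)) x)) ∂μ := by
          gcongr ENNReal.ofReal b * ?_
          exact setLIntegral_mono' (hQ k) hpt
      _ = _ := by
          rw [lintegral_add_left (measurable_missProb_comp hg _ _
            (measurable_bayesClassifier (hη σ))), mul_add]
  -- The bound is proved on average over all sign vectors; flipping the sign at `k` permutes them,
  -- so each pair sum amounts to `2 * G σ k`.
  by_contra! hlt
  have hsum1 : ∑ σ, 2 * excessRisk μ (η σ) (K σ) g
      < ∑ _σ : ι → Bool, (J.card : ℝ≥0∞) * (ENNReal.ofReal b * (8⁻¹ * w)) :=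
    ENNReal.sum_lt_sum_of_nonempty Finset.univ_nonempty fun σ _ => hlt σ
  refine absurd hsum1 (not_lt.2 ?_)
  calc _ = ∑ _σ : ι → Bool, ∑ k ∈ J, ENNReal.ofReal b * (8⁻¹ * w) := by simp
    _ ≤ ∑ σ, ∑ k ∈ J, (G σ k + G (flip k σ) k) :=
        Finset.sum_le_sum fun σ _ => Finset.sum_le_sum fun k hk => hpair σ k hk
    _ = ∑ σ, ∑ k ∈ J, 2 * G σ k := by
        rw [Finset.sum_comm, Finset.sum_comm (s := Finset.univ)]
        refine Finset.sum_congr rfl fun k _ => ?_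
        have e : ∑ σ, G (flip k σ) k = ∑ σ, G σ k :=
          Equiv.sum_comp (hflip k).toPerm fun σ => G σ k
        simp only [two_mul, Finset.sum_add_distrib, e]
    _ ≤ _ := Finset.sum_le_sum fun σ _ => by
        rw [← Finset.mul_sum]
        gcongr
        exact hGle σ

/-- If the perturbation moves the points of `Qp k` by `-ω u` and those of `Qm k` by `ω u`, with
the same law of `u`, then perturbed points of both classes coincide, and any classifier has
a large excess risk. -/
theorem le_excessRisk_of_confusion {c : ℝ≥0∞} {X : Set (Feature d)}
    [IsProbabilityMeasure (c • volume.restrict X : Measure (Feature d))]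
    {η : Feature d → ℝ} (hη : Measurable η) (h0 : ∀ x, 0 ≤ η x) (h1 : ∀ x, η x ≤ 1)
    (K : Kernel (Feature d) (Feature d)) {g : Classifier d n} (hg : Measurable g)
    (J : Finset ι) {Qp Qm Qs : ι → Set (Feature d)}
    (hQp : ∀ k, MeasurableSet (Qp k)) (hQm : ∀ k, MeasurableSet (Qm k))
    (hQs : ∀ k, MeasurableSet (Qs k)) (hsp : ∀ k, Qs k ⊆ Qp k) (hpX : ∀ k, Qp k ⊆ X)
    (hmX : ∀ k, Qm k ⊆ X)
    (hdisj : Set.PairwiseDisjoint (↑J) fun k => Qp k ∪ Qm k)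
    {b : ℝ} (hb : ∀ k ∈ J, ∀ x ∈ Qp k ∪ Qm k, b ≤ |2 * η x - 1|)
    (hbp : ∀ k ∈ J, ∀ x ∈ Qp k, 1 / 2 < η x) (hbm : ∀ k ∈ J, ∀ x ∈ Qm k, η x < 1 / 2)
    (ρ : Measure (Feature d)) [IsProbabilityMeasure ρ] {ω : ℝ}
    (hKp : ∀ k ∈ J, ∀ x ∈ Qp k, K x = ρ.map fun u => x - ω • u)
    (hKm : ∀ k ∈ J, ∀ x ∈ Qm k, K x = ρ.map fun u => x + ω • u)
    {T : Set (Feature d)} (hT : MeasurableSet T)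
    (hTQ : ∀ u ∈ T, ∀ k ∈ J, ∀ x ∈ Qs k, x - (2 * ω) • u ∈ Qm k)
    {w : ℝ≥0∞} (hw : ∀ k ∈ J, w ≤ (c • volume.restrict X : Measure (Feature d)) (Qs k)) :
    (J.card : ℝ≥0∞) * (ENNReal.ofReal b * (w * ρ T))
      ≤ excessRisk (c • volume.restrict X) η K g := by
  set μ : Measure (Feature d) := c • volume.restrict X with hμ
  have hP := isProbabilityMeasure_labelledLaw μ hη h0 h1
  refine le_trans ?_ (sum_setLIntegral_missProb_le_excessRisk μ K J
    (fun k => (hQp k).union (hQm k)) hdisj hb)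
  rw [← nsmul_eq_mul, ← Finset.sum_const]
  refine Finset.sum_le_sum fun k hk => ?_
  gcongr ENNReal.ofReal b * ?_
  set R := Measure.pi fun _ : Fin n => labelledLaw μ η
  set h : Bool → Feature d → ℝ≥0∞ := fun y z => R {D | g (D, z) ≠ y} with hh
  have mh : ∀ y, Measurable (h y) := fun y => measurable_measure_classifier_ne hg R y
  have hone : ∀ z, h true z + h false z = 1 := by
    intro z
    have e : {D | g (D, z) ≠ false} = {D | g (D, z) ≠ true}ᶜ := by
      ext D; simp
    simp only [hh]
    rw [e, measure_add_measure_compl (measurableSet_classifier_ne hg z true), measure_univ]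
  have hpm : Disjoint (Qp k) (Qm k) := Set.disjoint_left.2 fun x hp hm =>
    absurd (hbp k hk x hp) (not_lt.2 (hbm k hk x hm).le)
  have ep : ∫⁻ x in Qp k, missProb R K g x (bayesClassifier η x) ∂μ
      = ∫⁻ x in Qp k, ∫⁻ u, h true (x - ω • u) ∂ρ ∂μ := by
    refine setLIntegral_congr_fun (hQp k) fun x hx => ?_
    have e : bayesClassifier η x = true := by
      simpa [bayesClassifier] using hbp k hk x hx
    simp only [e, missProb]
    rw [hKp k hk x hx, lintegral_map (mh true) (by fun_prop)]
  have em : ∫⁻ x in Qm k, missProb R K g x (bayesClassifier η x) ∂μ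
      = ∫⁻ x in Qm k, ∫⁻ u, h false (x + ω • u) ∂ρ ∂μ := by
    refine setLIntegral_congr_fun (hQm k) fun x hx => ?_
    have e : bayesClassifier η x = false := by
      simpa [bayesClassifier] using (hbm k hk x hx).le
    simp only [e, missProb]
    rw [hKm k hk x hx, lintegral_map (mh false) (by fun_prop)]
  have hres : ∀ {S : Set (Feature d)}, MeasurableSet S → S ⊆ X →
      μ.restrict S = c • volume.restrict S := by
    intro S hS hSX
    rw [hμ, Measure.restrict_smul, Measure.restrict_restrict hS, Set.inter_eq_left.2 hSX]
  have mt : Measurable fun p : Feature d × Feature d => h true (p.1 - ω • p.2) :=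
    (mh true).comp (measurable_fst.sub (measurable_snd.const_smul ω))
  have mf : Measurable fun p : Feature d × Feature d => h false (p.1 + ω • p.2) :=
    (mh false).comp (measurable_fst.add (measurable_snd.const_smul ω))
  have st : ∫⁻ x in Qp k, ∫⁻ u, h true (x - ω • u) ∂ρ ∂μ
      = ∫⁻ u, ∫⁻ x in Qp k, h true (x - ω • u) ∂μ ∂ρ := lintegral_lintegral_swap mt.aemeasurable
  have sf : ∫⁻ x in Qm k, ∫⁻ u, h false (x + ω • u) ∂ρ ∂μ
      = ∫⁻ u, ∫⁻ x in Qm k, h false (x + ω • u) ∂μ ∂ρ := lintegral_lintegral_swap mf.aemeasurable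
  rw [lintegral_union (hQm k) hpm, ep, em, st, sf]
  -- For a fixed direction `u`, translation by `(2 * ω) • u` carries `Qs k` into `Qm k`, and both
  -- points are observed at `x - ω • u`. There the two error probabilities sum to 1, and Lebesgue
  -- measure is translation invariant.
  have key : ∀ u ∈ T, w ≤ ∫⁻ x in Qp k, h true (x - ω • u) ∂μ
      + ∫⁻ x in Qm k, h false (x + ω • u) ∂μ := by
    intro u hu
    have hm' : ∫⁻ x in Qs k, h false (x - ω • u) ∂μ ≤ ∫⁻ x in Qm k, h false (x + ω • u) ∂μ := by
      rw [hres (hQs k) ((hsp k).trans (hpX k)), hres (hQm k) (hmX k), lintegral_smul_measure,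
        lintegral_smul_measure]
      gcongr c • ?_
      rw [← lintegral_indicator (hQs k), ← lintegral_indicator (hQm k),
        ← lintegral_sub_right_eq_self
          ((Qm k).indicator fun a => h false (a + ω • u)) ((2 * ω) • u)]
      refine lintegral_mono fun x => ?_
      by_cases hx : x ∈ Qs k
      · simp only [Set.indicator_of_mem hx, Set.indicator_of_mem (hTQ u hu k hk x hx)]
        rw [show x - (2 * ω) • u + ω • u = x - ω • u by module]
      · simp [hx]
    calc w ≤ μ (Qs k) := hw k hk
      _ = ∫⁻ x in Qs k, (h true (x - ω • u) + h false (x - ω • u)) ∂μ := by simp [hone]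
      _ = ∫⁻ x in Qs k, h true (x - ω • u) ∂μ + ∫⁻ x in Qs k, h false (x - ω • u) ∂μ :=
          lintegral_add_left ((mh true).comp (by fun_prop)) _
      _ ≤ _ := add_le_add (lintegral_mono_set (hsp k)) hm'
  calc w * ρ T = ∫⁻ _ in T, w ∂ρ := by simp
    _ ≤ ∫⁻ u in T, (∫⁻ x in Qp k, h true (x - ω • u) ∂μ
      + ∫⁻ x in Qm k, h false (x + ω • u) ∂μ) ∂ρ := setLIntegral_mono' hT key
    _ ≤ ∫⁻ u, (∫⁻ x in Qp k, h true (x - ω • u) ∂μ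
      + ∫⁻ x in Qm k, h false (x + ω • u) ∂μ) ∂ρ := setLIntegral_le_lintegral _ _
    _ = _ := lintegral_add_left
      mt.lintegral_prod_left' _

end LowerBounds

/-! ### The perturbations -/

section Perturbation

variable {d : ℕ}

/-- `K` moves every point `x`, near which `η` is affine in the coordinate `i` and takes the value
`1/2` on the hyperplane `{w | w i = t}`, towards this hyperplane (`u` being thought of as close
to the unit vector of the coordinate `i`, and distributed according to `ρ`). -/
structure PushesTowards (i : Fin d) (ρ : Measure (Feature d)) (ω : ℝ) (η : Feature d → ℝ)
    (K : Kernel (Feature d) (Feature d)) : Prop where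
  isMarkovKernel : IsMarkovKernel K
  eq_map_sub : ∀ (x : Feature d) (t c : ℝ), c ≠ 0 →
    (∀ w ∈ Metric.closedBall x ω, η w = 1 / 2 + c * (w i - t)) → t < x i →
    K x = ρ.map fun u => x - ω • u
  eq_map_add : ∀ (x : Feature d) (t c : ℝ), c ≠ 0 →
    (∀ w ∈ Metric.closedBall x ω, η w = 1 / 2 + c * (w i - t)) → x i < t →
    K x = ρ.map fun u => x + ω • u

theorem isProbabilityMeasure_unifUnitSphere (hd : 1 ≤ d) :
    IsProbabilityMeasure (unifUnitSphere d) := by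
  have : Nonempty (Fin d) := ⟨⟨0, hd⟩⟩
  have : Nontrivial (Feature d) := inferInstance
  have h0 : (volume : Measure (Feature d)).toSphere Set.univ ≠ 0 :=
    Measure.measure_univ_ne_zero.2 (volume : Measure (Feature d)).toSphere_ne_zero
  constructor
  rw [unifUnitSphere, Measure.map_apply measurable_subtype_coe .univ, Set.preimage_univ,
    Measure.smul_apply, smul_eq_mul, ENNReal.inv_mul_cancel h0 (measure_ne_top _ _)]

theorem randomPerturbation_apply (hd : 1 ≤ d) (ω : ℝ) (x : Feature d) :
    randomPerturbation d ω x = (unifUnitSphere d).map fun u => x + ω • u := by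
  have := isProbabilityMeasure_unifUnitSphere hd
  rw [randomPerturbation, Kernel.map_apply _ (by fun_prop), Kernel.prod_apply, Kernel.id_apply,
    Kernel.const_apply, Measure.dirac_prod, Measure.map_map (by fun_prop) (by fun_prop)]
  rfl

theorem isMarkovKernel_randomPerturbation (hd : 1 ≤ d) (ω : ℝ) :
    IsMarkovKernel (randomPerturbation d ω) := by
  have := isProbabilityMeasure_unifUnitSphere hd
  rw [randomPerturbation]
  exact Kernel.IsMarkovKernel.map _ (by fun_prop)

/-- Surface measure is the Lebesgue measure of the cone over a set, up to a factor, so it inherits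
the invariance of Lebesgue measure under negation. -/
theorem map_neg_unifUnitSphere : (unifUnitSphere d).map (fun u => -u) = unifUnitSphere d := by
  ext s hs
  have h : ∀ s : Set (Feature d), MeasurableSet s → unifUnitSphere d s
      = ((volume : Measure (Feature d)).toSphere Set.univ)⁻¹ *
        (Module.finrank ℝ (Feature d) *
          volume (Set.Ioo (0 : ℝ) 1 • (Subtype.val ''
            ((Subtype.val : Metric.sphere (0 : Feature d) 1 → Feature d) ⁻¹' s)))) := by
    intro s hs
    rw [unifUnitSphere, Measure.map_apply measurable_subtype_coe hs, Measure.smul_apply,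
      smul_eq_mul, Measure.toSphere_apply' _ (measurable_subtype_coe hs)]
  rw [Measure.map_apply measurable_neg hs, h _ hs, h _ (measurable_neg hs)]
  congr 2
  rw [← Measure.measure_neg]
  congr 1
  ext x
  simp only [Set.mem_neg, Set.mem_smul, Set.mem_image, Set.mem_preimage]
  constructor
  · rintro ⟨r, hr, _, ⟨u, hu, rfl⟩, h⟩
    exact ⟨r, hr, _, ⟨-u, by simpa using hu, rfl⟩, by simp [h]⟩
  · rintro ⟨r, hr, _, ⟨u, hu, rfl⟩, h⟩
    exact ⟨r, hr, _, ⟨-u, by simpa using hu, rfl⟩, by simp [h]⟩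

theorem unifUnitSphere_ball_pos {e : Feature d} (he : ‖e‖ = 1) {δ : ℝ}
    (hδ : 0 < δ) : 0 < unifUnitSphere d (Metric.ball e δ) := by
  rw [unifUnitSphere, Measure.map_apply measurable_subtype_coe measurableSet_ball,
    Measure.smul_apply, smul_eq_mul]
  refine ENNReal.mul_pos (ENNReal.inv_ne_zero.2 (measure_ne_top _ _)) ?_
  refine (IsOpen.measure_pos _ (Metric.isOpen_ball.preimage continuous_subtype_val)
    ⟨⟨e, by simpa using he⟩, ?_⟩).ne'
  simpa using hδ

theorem pushesTowards_randomPerturbation (hd : 1 ≤ d) (i : Fin d) (ω : ℝ) (η : Feature d → ℝ) :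
    PushesTowards i (unifUnitSphere d) ω η (randomPerturbation d ω) where
  isMarkovKernel := isMarkovKernel_randomPerturbation hd ω
  eq_map_sub x t c _ _ _ := by
    rw [randomPerturbation_apply hd]
    conv_lhs => rw [← map_neg_unifUnitSphere]
    rw [Measure.map_map (by fun_prop) (by fun_prop)]
    congr 1
    funext u
    simp [sub_eq_add_neg]
  eq_map_add x t c _ _ _ := randomPerturbation_apply hd ω x

/-- The lowest point of a ball in a coordinate direction is unique. -/
theorem eq_sub_smul_single_of_le (i : Fin d) {x z : Feature d} {ω : ℝ} (hω : 0 ≤ ω)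
    (hz : z ∈ Metric.closedBall x ω) (h : z i ≤ x i - ω) :
    z = x - ω • EuclideanSpace.single i (1 : ℝ) := by
  rw [mem_closedBall_iff_norm] at hz
  -- The square expands to `‖z - x‖² + 2ω(z i - x i) + ω² ≤ ω² - 2ω² + ω²`.
  have h1 : ‖z - x + ω • EuclideanSpace.single i (1 : ℝ)‖ ^ 2 ≤ 0 := by
    rw [norm_add_sq_real, norm_smul, inner_smul_right, EuclideanSpace.inner_single_right]
    simp
    have := pow_le_pow_left₀ (norm_nonneg _) hz 2
    nlinarith
  have h2 : z - x + ω • EuclideanSpace.single i (1 : ℝ) = 0 := by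
    rw [← norm_eq_zero]
    exact pow_eq_zero_iff two_ne_zero |>.1 (le_antisymm h1 (by positivity))
  rw [← sub_eq_zero, ← h2]
  abel

theorem eq_add_smul_single_of_le (i : Fin d) {x z : Feature d} {ω : ℝ} (hω : 0 ≤ ω)
    (hz : z ∈ Metric.closedBall x ω) (h : x i + ω ≤ z i) :
    z = x + ω • EuclideanSpace.single i (1 : ℝ) := by
  have := eq_sub_smul_single_of_le i (x := -x) (z := -z) hω
    (by simpa [mem_closedBall_iff_norm, neg_add_eq_sub, norm_sub_rev] using hz)
    (by simp; linarith)
  rw [← neg_inj, this]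
  abel

theorem add_smul_single_mem_closedBall (i : Fin d) (x : Feature d) {ω : ℝ} (hω : 0 ≤ ω) :
    x + ω • EuclideanSpace.single i (1 : ℝ) ∈ Metric.closedBall x ω := by
  simp [norm_smul, abs_of_nonneg hω]

theorem sub_smul_single_mem_closedBall (i : Fin d) (x : Feature d) {ω : ℝ} (hω : 0 ≤ ω) :
    x - ω • EuclideanSpace.single i (1 : ℝ) ∈ Metric.closedBall x ω := by
  simp [norm_smul, abs_of_nonneg hω]

theorem eq_dirac_of_compl_singleton {α : Type*} [MeasurableSpace α] [MeasurableSingletonClass α]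
    (μ : Measure α) [IsProbabilityMeasure μ] {a : α} (h : μ {a}ᶜ = 0) : μ = Measure.dirac a := by
  have h1 : μ {a} = 1 := by
    rw [prob_compl_eq_zero_iff (measurableSet_singleton a)] at h
    exact h
  ext s hs
  rw [Measure.dirac_apply' a hs]
  by_cases ha : a ∈ s
  · rw [Set.indicator_of_mem ha]
    exact le_antisymm prob_le_one (h1.symm.trans_le (measure_mono (Set.singleton_subset_iff.2 ha)))
  · rw [Set.indicator_of_notMem ha]
    exact measure_mono_null (fun x hx (hxa : x = a) => ha (hxa ▸ hx)) h

/-- The side of the hyperplane and the value of `η x` determine the sign of the slope `c`. In both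
branches of the attack, optimality against the extreme point of the ball towards the hyperplane
forces `z` to be that point, so there are no ties to break here. -/
theorem IsAttack.pushesTowards (i : Fin d) {ω : ℝ} (hω : 0 ≤ ω) {η : Feature d → ℝ}
    {K : Kernel (Feature d) (Feature d)} (hK : IsAttack ω η K) :
    PushesTowards i (Measure.dirac (EuclideanSpace.single i (1 : ℝ))) ω η K where
  isMarkovKernel := hK.1
  eq_map_sub x t c hc hlin hx := by
    have := hK.1
    rw [Measure.map_dirac' (f := fun u : Feature d => x - ω • u) (by fun_prop)]
    refine eq_dirac_of_compl_singleton _ (measure_mono_null (Set.compl_subset_compl.2 ?_) (hK.2 x))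
    rintro z ⟨hz, h⟩
    refine eq_sub_smul_single_of_le i hω hz ?_
    have hmem := sub_smul_single_mem_closedBall i x hω
    have hx0 := hlin x (Metric.mem_closedBall_self hω)
    have hz0 := hlin z hz
    have hw0 := hlin _ hmem
    simp at hw0
    rcases h with ⟨hη, h⟩ | ⟨hη, h⟩
    · have h2 := h _ hmem
      have hc0 : 0 < c := pos_of_mul_pos_left (b := x i - t) (by linarith) (by linarith)
      have : c * (z i) ≤ c * (x i - ω) := by nlinarith
      exact le_of_mul_le_mul_left this hc0
    · have h2 := h _ hmem
      have hc0 : c < 0 := lt_of_le_of_ne (by by_contra! h; nlinarith) hc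
      nlinarith
  eq_map_add x t c hc hlin hx := by
    have := hK.1
    rw [Measure.map_dirac' (f := fun u : Feature d => x + ω • u) (by fun_prop)]
    refine eq_dirac_of_compl_singleton _ (measure_mono_null (Set.compl_subset_compl.2 ?_) (hK.2 x))
    rintro z ⟨hz, h⟩
    refine eq_add_smul_single_of_le i hω hz ?_
    have hmem := add_smul_single_mem_closedBall i x hω
    have hx0 := hlin x (Metric.mem_closedBall_self hω)
    have hz0 := hlin z hz
    have hw0 := hlin _ hmem
    simp at hw0
    rcases h with ⟨hη, h⟩ | ⟨hη, h⟩
    · have h2 := h _ hmem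
      have hc0 : c < 0 := by by_contra! h; nlinarith
      nlinarith
    · have h2 := h _ hmem
      have hc0 : 0 < c := lt_of_le_of_ne (by by_contra! h; nlinarith) hc.symm
      nlinarith

end Perturbation

/-! ### The local profile of the regression functions -/

section Profile

variable {d : ℕ}

/-- The coordinate `i`, truncated so that it vanishes outside of the ball of radius `R`. -/
def profile (i : Fin d) (R : ℝ) (y : Feature d) : ℝ :=
  max (-max 0 (R - ‖y‖)) (min (y i) (max 0 (R - ‖y‖)))

theorem lipschitzWith_profile (i : Fin d) (R : ℝ) : LipschitzWith 1 (profile i R) := by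
  have h1 : LipschitzWith 1 fun y : Feature d => R - ‖y‖ :=
    LipschitzWith.of_dist_le_mul fun x y => by
      rw [Real.dist_eq, NNReal.coe_one, one_mul, dist_eq_norm,
        show R - ‖x‖ - (R - ‖y‖) = -(‖x‖ - ‖y‖) by ring, abs_neg]
      exact abs_norm_sub_norm_le x y
  have h2 : LipschitzWith 1 fun y : Feature d => max 0 (R - ‖y‖) := h1.const_max 0
  have h3 : LipschitzWith 1 fun y : Feature d => y i :=
    LipschitzWith.of_dist_le_mul fun x y => by
      rw [Real.dist_eq, NNReal.coe_one, one_mul, dist_eq_norm]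
      simpa only [PiLp.sub_apply, Real.norm_eq_abs] using PiLp.norm_apply_le (x - y) i
  have h4 := h2.neg.max (h3.min h2)
  simp only [max_self] at h4
  exact h4

theorem abs_profile_le (i : Fin d) (R : ℝ) (y : Feature d) :
    |profile i R y| ≤ max 0 (R - ‖y‖) :=
  abs_le.2 ⟨le_max_left _ _, max_le (by linarith [le_max_left 0 (R - ‖y‖)]) (min_le_right _ _)⟩

theorem profile_eq_zero (i : Fin d) {R : ℝ} {y : Feature d} (h : R ≤ ‖y‖) :
    profile i R y = 0 := by
  have := abs_profile_le i R y
  rw [max_eq_left (by linarith)] at this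
  exact abs_nonpos_iff.1 this

/-- Here `|y i| ≤ ‖y‖ ≤ R - ‖y‖`, so the truncation is inactive. -/
theorem profile_eq_apply (i : Fin d) {R : ℝ} {y : Feature d} (h : 2 * ‖y‖ ≤ R) :
    profile i R y = y i := by
  have h1 : |y i| ≤ ‖y‖ := by simpa using PiLp.norm_apply_le y i
  have h2 := abs_le.1 h1
  rw [profile, max_eq_right (a := 0) (by linarith [norm_nonneg y]), min_eq_left (by linarith),
    max_eq_right (by linarith)]

end Profile

/-! ### A periodic set of small cubes -/

section Lattice

variable {d M : ℕ}

theorem norm_le_sum_abs (x : Feature d) : ‖x‖ ≤ ∑ i, |x i| := by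
  rw [EuclideanSpace.norm_eq]
  apply Real.sqrt_le_iff.2 ⟨Finset.sum_nonneg fun i _ => abs_nonneg _, ?_⟩
  simp only [Real.norm_eq_abs]
  exact Finset.sum_sq_le_sq_sum_of_nonneg fun i _ => abs_nonneg _

theorem norm_le_mul_of_abs_le {x : Feature d} {a : ℝ} (h : ∀ i, |x i| ≤ a) : ‖x‖ ≤ d * a :=
  (norm_le_sum_abs x).trans ((Finset.sum_le_sum fun i _ => h i).trans_eq (by simp))

theorem volume_forall_mem (A : Fin d → Set ℝ) (hA : ∀ i, MeasurableSet (A i)) :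
    volume {x : Feature d | ∀ i, x i ∈ A i} = ∏ i, volume (A i) := by
  have h := (PiLp.volume_preserving_ofLp (Fin d)).measure_preimage
    (MeasurableSet.univ_pi hA).nullMeasurableSet
  rw [← volume_pi_pi, ← h]
  congr 1
  ext x
  simp

theorem measurableSet_forall_mem {A : Fin d → Set ℝ} (hA : ∀ i, MeasurableSet (A i)) :
    MeasurableSet {x : Feature d | ∀ i, x i ∈ A i} := by
  rw [Set.ofPred_forall]
  exact MeasurableSet.iInter fun i => (hA i).preimage (by fun_prop)

/-- The two intervals of length `s` at distance `s / 2` from `c`. -/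
def shell (s c : ℝ) : Set ℝ := {t | s / 2 ≤ |t - c| ∧ |t - c| ≤ 3 * s / 2}

theorem isClosed_shell (s c : ℝ) : IsClosed (shell s c) :=
  (isClosed_le (f := fun _ => s / 2) (g := fun t => |t - c|) (by fun_prop) (by fun_prop)).inter
    (isClosed_le (f := fun t => |t - c|) (g := fun _ => 3 * s / 2) (by fun_prop) (by fun_prop))

theorem shell_eq {s : ℝ} (hs : 0 < s) (c : ℝ) :
    shell s c = Set.Icc (c - 3 * s / 2) (c - s / 2) ∪ Set.Icc (c + s / 2) (c + 3 * s / 2) := by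
  ext t
  simp only [shell, Set.mem_ofPred_eq, Set.mem_union, Set.mem_Icc]
  rcases le_total 0 (t - c) with h | h
  · rw [abs_of_nonneg h]
    constructor
    · rintro ⟨h1, h2⟩; right; constructor <;> linarith
    · rintro (⟨h1, h2⟩ | ⟨h1, h2⟩) <;> constructor <;> linarith
  · rw [abs_of_nonpos h]
    constructor
    · rintro ⟨h1, h2⟩; left; constructor <;> linarith
    · rintro (⟨h1, h2⟩ | ⟨h1, h2⟩) <;> constructor <;> linarith

theorem volume_shell {s : ℝ} (hs : 0 < s) (c : ℝ) : volume (shell s c) = ENNReal.ofReal (2 * s) := by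
  rw [shell_eq hs, measure_union _ measurableSet_Icc, Real.volume_Icc, Real.volume_Icc,
    ← ENNReal.ofReal_add (by linarith) (by linarith)]
  · congr 1; ring
  · refine Set.disjoint_left.2 fun t h1 h2 => ?_
    linarith [h1.2, h2.1]

theorem abs_natCast_sub_ge_one {a b : ℕ} (h : a ≠ b) : (1 : ℝ) ≤ |(a : ℝ) - b| := by
  have : (a : ℤ) - b ≠ 0 := sub_ne_zero.2 (by exact_mod_cast h)
  exact_mod_cast Int.one_le_abs this

theorem disjoint_shell {s h : ℝ} (hs : 0 < s) (hh : 4 * s ≤ h) {a b : ℕ} (hab : a ≠ b) :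
    Disjoint (shell s (h * a)) (shell s (h * b)) := by
  refine Set.disjoint_left.2 fun t h1 h2 => ?_
  have h3 : h * 1 ≤ |h * a - h * b| := by
    rw [← mul_sub, abs_mul, abs_of_pos (by linarith)]
    exact mul_le_mul_of_nonneg_left (abs_natCast_sub_ge_one hab) (by linarith)
  have h4 := abs_sub_le (h * a) t (h * b)
  rw [abs_sub_comm (h * a) t] at h4
  linarith [h1.2, h2.2]

/-- The union of `M` shells with spacing `h`. -/
def shells (s h : ℝ) (M : ℕ) : Set ℝ := ⋃ j : Fin M, shell s (h * (j : ℕ))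

theorem measurableSet_shells (s h : ℝ) (M : ℕ) : MeasurableSet (shells s h M) :=
  MeasurableSet.iUnion fun _ => (isClosed_shell _ _).measurableSet

/-- The union of the shells has positive density, at every scale up to `1`, around each of its
points. -/
theorem le_volume_shells_inter {s D : ℝ} (hs : 0 < s) (hD : 10 ≤ D) (hM : 1 ≤ s * M)
    {x : ℝ} (hx : x ∈ shells s (D * s) M) {r : ℝ} (hr : 0 < r) (hr1 : r ≤ 1) :
    ENNReal.ofReal (r / (2 * D)) ≤ volume (shells s (D * s) M ∩ Set.Ioo (x - r) (x + r)) := by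
  obtain ⟨k, hk⟩ := Set.mem_iUnion.1 hx
  rcases lt_or_ge r (8 * s) with hr8 | hr8
  -- Small radius: `x` lies in an interval of length `s` of its own shell, which contains an
  -- interval of length `m ≤ s / 2` on one side of `x`. Since `r < 8s`, `r / 10 ≤ min r s`, which
  -- with `D ≥ 10` gives `r / (2D) ≤ m`.
  · set m := min r s / 2 with hm
    have hm0 : 0 < m := by have := lt_min hr hs; positivity
    have hmr : 2 * m ≤ r := by rw [hm]; linarith [min_le_left r s]
    have hms : 2 * m ≤ s := by rw [hm]; linarith [min_le_right r s]
    have hrm : r / (2 * D) ≤ m := by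
      have h1 : r / (2 * D) ≤ r / 20 := by gcongr; linarith
      have h2 : r / 10 ≤ min r s := le_min (by linarith) (by linarith)
      linarith
    have hsub : Set.Icc x (x + m) ⊆ shell s (D * s * (k : ℕ))
        ∨ Set.Icc (x - m) x ⊆ shell s (D * s * (k : ℕ)) := by
      rw [shell_eq hs] at hk ⊢
      rcases hk with hk | hk
      · rcases le_total x (D * s * (k : ℕ) - s) with h | h
        · exact Or.inl fun t ht => Or.inl ⟨by linarith [hk.1, ht.1], by linarith [ht.2]⟩
        · exact Or.inr fun t ht => Or.inl ⟨by linarith [ht.1], by linarith [hk.2, ht.2]⟩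
      · rcases le_total x (D * s * (k : ℕ) + s) with h | h
        · exact Or.inl fun t ht => Or.inr ⟨by linarith [hk.1, ht.1], by linarith [ht.2]⟩
        · exact Or.inr fun t ht => Or.inr ⟨by linarith [ht.1], by linarith [hk.2, ht.2]⟩
    have hshell : shell s (D * s * (k : ℕ)) ⊆ shells s (D * s) M :=
      Set.subset_iUnion (fun j : Fin M => shell s (D * s * (j : ℕ))) k
    rcases hsub with h | h
    · calc ENNReal.ofReal (r / (2 * D)) ≤ ENNReal.ofReal m := ENNReal.ofReal_le_ofReal hrm
        _ = volume (Set.Icc x (x + m)) := by simp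
        _ ≤ _ := measure_mono (Set.subset_inter (h.trans hshell)
          fun t ht => Set.mem_Ioo.2 ⟨by linarith [ht.1], by linarith [ht.2]⟩)
    · calc ENNReal.ofReal (r / (2 * D)) ≤ ENNReal.ofReal m := ENNReal.ofReal_le_ofReal hrm
        _ = volume (Set.Icc (x - m) x) := by simp
        _ ≤ _ := measure_mono (Set.subset_inter (h.trans hshell)
          fun t ht => Set.mem_Ioo.2 ⟨by linarith [ht.1], by linarith [ht.2]⟩)
  · have hDs : 0 < D * s := by positivity
    -- Large radius: shells at index distance at most `j` from `k` lie within `j D s + 3s < r` of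
    -- `x`. As `r ≥ 8s`, one has `r ≤ 2(r - 4s) < 2(j + 1) D s`, so `j + 1` of them have enough
    -- length.
    set j := ⌊(r - 4 * s) / (D * s)⌋₊ with hj
    have hj1 : j * (D * s) ≤ r - 4 * s := by
      have := Nat.floor_le (a := (r - 4 * s) / (D * s)) (div_nonneg (by linarith) hDs.le)
      rwa [le_div_iff₀ hDs] at this
    have hj2 : r - 4 * s < (j + 1) * (D * s) := by
      have := Nat.lt_floor_add_one ((r - 4 * s) / (D * s))
      rwa [div_lt_iff₀ hDs] at this
    have hjM : 10 * j < M := by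
      have h1 : (j : ℝ) * (D * s) < s * M := by linarith
      have h2 : (j : ℝ) * D < M := by
        have : s * (j * D) < s * M := by linarith
        exact lt_of_mul_lt_mul_left this hs.le
      have h3 : (10 * j : ℝ) < M := by nlinarith [(Nat.cast_nonneg j : (0 : ℝ) ≤ j)]
      exact_mod_cast h3
    have hkM := k.2
    -- A window of `j + 1` consecutive indices, ending at `k` if it fits and otherwise starting at
    -- `k`, where `k + j ≤ 2j < M`.
    obtain ⟨a, haM, ha⟩ : ∃ a : ℕ, a + j < M ∧
        ∀ l ≤ j, |((a + l : ℕ) : ℝ) - (k : ℕ)| ≤ j := by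
      rcases le_total j (k : ℕ) with h | h
      · refine ⟨k - j, by omega, fun l hl => ?_⟩
        rw [Nat.cast_add, Nat.cast_sub h, abs_le]
        have : (l : ℝ) ≤ j := by exact_mod_cast hl
        constructor <;> linarith [(Nat.cast_nonneg l : (0 : ℝ) ≤ l)]
      · refine ⟨k, by omega, fun l hl => ?_⟩
        rw [Nat.cast_add, abs_le]
        have : (l : ℝ) ≤ j := by exact_mod_cast hl
        constructor <;> linarith [(Nat.cast_nonneg l : (0 : ℝ) ≤ l)]
    calc ENNReal.ofReal (r / (2 * D)) ≤ ENNReal.ofReal ((j + 1 : ℕ) * (2 * s)) := by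
          apply ENNReal.ofReal_le_ofReal
          rw [div_le_iff₀ (by linarith)]
          push_cast
          nlinarith
      _ = ∑ l ∈ Finset.range (j + 1), volume (shell s (D * s * ((a + l : ℕ) : ℝ))) := by
          simp only [volume_shell hs, Finset.sum_const, Finset.card_range, nsmul_eq_mul]
          rw [ENNReal.ofReal_mul (by positivity), ENNReal.ofReal_natCast]
      _ = volume (⋃ l ∈ Finset.range (j + 1), shell s (D * s * ((a + l : ℕ) : ℝ))) := by
          refine (measure_biUnion_finset (fun l _ l' _ hl => ?_)
            fun l _ => (isClosed_shell _ _).measurableSet).symm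
          exact disjoint_shell hs (by nlinarith) (by omega)
      _ ≤ _ := by
          refine measure_mono (Set.iUnion₂_subset fun l hl t ht => ?_)
          have hlj : l ≤ j := Nat.lt_succ_iff.1 (Finset.mem_range.1 hl)
          refine ⟨Set.mem_iUnion.2 ⟨⟨a + l, by omega⟩, ht⟩, ?_⟩
          have h1 := abs_le.1 ht.2
          have h2 := abs_le.1 hk.2
          have h3 := abs_le.1 (ha l hlj)
          constructor <;> nlinarith

/-- The site of the lattice with index `k`. -/
def site (h : ℝ) (k : Fin d → Fin M) : Feature d := WithLp.toLp 2 fun i => h * ((k i : ℕ) : ℝ)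

@[simp]
theorem site_apply (h : ℝ) (k : Fin d → Fin M) (i : Fin d) :
    site h k i = h * ((k i : ℕ) : ℝ) := rfl

/-- The `2^d` cubes around the site with index `k`. -/
def cell (s h : ℝ) (k : Fin d → Fin M) : Set (Feature d) :=
  {x | ∀ i, x i ∈ shell s (h * ((k i : ℕ) : ℝ))}

/-- The cubes around all sites. -/
def cells (d M : ℕ) (s h : ℝ) : Set (Feature d) := ⋃ k : Fin d → Fin M, cell s h k

theorem cell_subset_cells (s h : ℝ) (k : Fin d → Fin M) : cell s h k ⊆ cells d M s h :=
  Set.subset_iUnion (fun k : Fin d → Fin M => cell s h k) k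

/-- The union of all cubes is a product set, so its regularity reduces to one-dimensional shells. -/
theorem cells_eq (s h : ℝ) : cells d M s h = {x | ∀ i, x i ∈ shells s h M} := by
  ext x
  simp only [cells, shells, cell, Set.mem_iUnion, Set.mem_ofPred_eq]
  exact ⟨fun ⟨k, hk⟩ i => ⟨k i, hk i⟩, fun hx => ⟨fun i => (hx i).choose, fun i => (hx i).choose_spec⟩⟩

theorem isClosed_cell (s h : ℝ) (k : Fin d → Fin M) : IsClosed (cell s h k) := by
  rw [cell, Set.ofPred_forall]
  exact isClosed_iInter fun i => (isClosed_shell _ _).preimage (by fun_prop)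

theorem isClosed_cells (s h : ℝ) : IsClosed (cells d M s h) :=
  isClosed_iUnion_of_finite fun k => isClosed_cell s h k

theorem volume_cell {s : ℝ} (hs : 0 < s) (h : ℝ) (k : Fin d → Fin M) :
    volume (cell s h k) = ENNReal.ofReal ((2 * s) ^ d) := by
  rw [cell, volume_forall_mem _ fun i => (isClosed_shell _ _).measurableSet]
  simp only [volume_shell hs, Finset.prod_const, Finset.card_univ, Fintype.card_fin]
  rw [ENNReal.ofReal_pow (by linarith)]

theorem dist_site_le {s h : ℝ} {k : Fin d → Fin M} {x : Feature d} (hx : x ∈ cell s h k) :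
    dist x (site h k) ≤ d * (3 * s / 2) := by
  rw [dist_eq_norm]
  exact norm_le_mul_of_abs_le fun i => (hx i).2

theorem cell_subset_ball {s h : ℝ} (hd : 1 ≤ d) (hs : 0 < s) (k : Fin d → Fin M) :
    cell s h k ⊆ Metric.ball (site h k) (5 * d * s) := fun x hx => by
  have hd' : (1 : ℝ) ≤ d := by exact_mod_cast hd
  have := dist_site_le hx
  rw [Metric.mem_ball]
  nlinarith

theorem disjoint_ball_site {s : ℝ} (hs : 0 < s) {k k' : Fin d → Fin M} (hk : k ≠ k') :
    Disjoint (Metric.ball (site (10 * d * s) k) (5 * d * s))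
      (Metric.ball (site (10 * d * s) k') (5 * d * s)) := by
  apply Metric.ball_disjoint_ball
  obtain ⟨i, hi⟩ := Function.ne_iff.1 hk
  have h1 : |site (10 * d * s) k i - site (10 * d * s) k' i|
      ≤ dist (site (10 * d * s) k) (site (10 * d * s) k') := by
    rw [dist_eq_norm]
    simpa only [PiLp.sub_apply, Real.norm_eq_abs] using
      PiLp.norm_apply_le (site (10 * d * s) k - site (10 * d * s) k') i
  refine le_trans ?_ h1
  rw [site_apply, site_apply, ← mul_sub, abs_mul, abs_of_nonneg (by positivity)]
  have := abs_natCast_sub_ge_one (fun h => hi (Fin.ext h) : ((k i : ℕ)) ≠ (k' i : ℕ))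
  calc 5 * (d : ℝ) * s + 5 * d * s = 10 * d * s * 1 := by ring
    _ ≤ _ := by gcongr

theorem disjoint_cell (hd : 1 ≤ d) {s : ℝ} (hs : 0 < s) {k k' : Fin d → Fin M} (hk : k ≠ k') :
    Disjoint (cell s (10 * d * s) k) (cell s (10 * d * s) k') :=
  (disjoint_ball_site hs hk).mono (cell_subset_ball hd hs k) (cell_subset_ball hd hs k')

/-- The ball carrying the bump of a site meets no other cubes, so its mass, which governs the
information on that sign, is that of one cell. -/
theorem cells_inter_ball (hd : 1 ≤ d) {s : ℝ} (hs : 0 < s) (k : Fin d → Fin M) :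
    cells d M s (10 * d * s) ∩ Metric.ball (site (10 * d * s) k) (5 * d * s)
      = cell s (10 * d * s) k := by
  refine Set.Subset.antisymm ?_ fun x hx => ⟨Set.mem_iUnion.2 ⟨k, hx⟩, cell_subset_ball hd hs k hx⟩
  rintro x ⟨hx, hxk⟩
  obtain ⟨k', hk'⟩ := Set.mem_iUnion.1 hx
  by_cases h : k = k'
  · exact h ▸ hk'
  · exact absurd (cell_subset_ball hd hs k' hk') (Set.disjoint_left.1 (disjoint_ball_site hs h) hxk)

theorem volume_cells (hd : 1 ≤ d) {s : ℝ} (hs : 0 < s) :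
    volume (cells d M s (10 * d * s)) = ENNReal.ofReal ((2 * s * M) ^ d) := by
  rw [cells, measure_iUnion (fun k k' hk => disjoint_cell hd hs hk)
    fun k => (isClosed_cell _ _ k).measurableSet, tsum_fintype]
  simp only [volume_cell hs, Finset.sum_const, Finset.card_univ, Fintype.card_fun, Fintype.card_fin,
    nsmul_eq_mul]
  rw [mul_pow (2 * s), mul_comm ((2 * s) ^ d), ENNReal.ofReal_mul (by positivity),
    ENNReal.ofReal_pow (by positivity), ENNReal.ofReal_pow (by positivity),
    ENNReal.ofReal_natCast, Nat.cast_pow]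

theorem isCompact_cells (s h : ℝ) : IsCompact (cells d M s h) := by
  refine isCompact_iUnion fun k => ?_
  refine Metric.isCompact_of_isClosed_isBounded (isClosed_cell s h k) ?_
  exact Metric.isBounded_closedBall.subset fun x hx => Metric.mem_closedBall.2 (dist_site_le hx)

/-- The constant `c₀` in the regularity of the set of cubes. -/
def regularityConst (d : ℕ) : ℝ :=
  (1 / (20 * (d : ℝ) ^ 2)) ^ d / volume.real (Metric.ball (0 : Feature d) 1)

theorem volume_real_ball_pos (x : Feature d) {r : ℝ} (hr : 0 < r) :
    0 < volume.real (Metric.ball x r) :=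
  ENNReal.toReal_pos (Metric.measure_ball_pos volume x hr).ne' measure_ball_lt_top.ne

theorem regularityConst_pos (hd : 1 ≤ d) : 0 < regularityConst d := by
  have : (0 : ℝ) < d := by exact_mod_cast hd
  exact div_pos (by positivity) (volume_real_ball_pos 0 one_pos)

theorem regularity_cells (hd : 1 ≤ d) {s : ℝ} (hs : 0 < s) (hM : 1 ≤ s * M) {x : Feature d}
    (hx : x ∈ cells d M s (10 * d * s)) {r : ℝ} (hr : 0 < r) (hr1 : r ≤ 1) :
    regularityConst d * volume.real (Metric.ball x r)
      ≤ volume.real (cells d M s (10 * d * s) ∩ Metric.ball x r) := by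
  have hd' : (1 : ℝ) ≤ d := by exact_mod_cast hd
  have : Nonempty (Fin d) := ⟨⟨0, hd⟩⟩
  have hball : volume.real (Metric.ball x r) = r ^ d * volume.real (Metric.ball (0 : Feature d) 1) := by
    rw [measureReal_def, Measure.addHaar_ball volume x hr.le, ENNReal.toReal_mul,
      ENNReal.toReal_ofReal (by positivity), measureReal_def, finrank_euclideanSpace_fin]
  have h0 := (volume_real_ball_pos (0 : Feature d) one_pos).ne'
  -- The ball contains a cube of half-side `r / d`; in each coordinate the shells with `D = 10 * d`
  -- fill a length of at least `(r / d) / (20 * d)`.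
  have hl : regularityConst d * volume.real (Metric.ball x r) = (r / d / (2 * (10 * d))) ^ d := by
    rw [hball, regularityConst]
    field_simp
    rw [← mul_pow]
    congr 1
    field_simp
    norm_num
  rw [hl, measureReal_def]
  refine (ENNReal.ofReal_le_iff_le_toReal ?_).1 ?_
  · exact ne_top_of_le_ne_top measure_ball_lt_top.ne (measure_mono Set.inter_subset_right)
  rw [cells_eq] at hx ⊢
  calc ENNReal.ofReal ((r / d / (2 * (10 * d))) ^ d)
      = ∏ _i : Fin d, ENNReal.ofReal (r / d / (2 * (10 * d))) := by
        rw [ENNReal.ofReal_pow (by positivity)]; simp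
    _ ≤ ∏ i : Fin d, volume (shells s (10 * d * s) M ∩ Set.Ioo (x i - r / d) (x i + r / d)) := by
        refine Finset.prod_le_prod' fun i _ => ?_
        exact le_volume_shells_inter hs (by linarith) hM (hx i) (by positivity)
          (by rw [div_le_one (by linarith)]; linarith)
    _ = volume {y : Feature d | ∀ i,
          y i ∈ shells s (10 * d * s) M ∩ Set.Ioo (x i - r / d) (x i + r / d)} :=
        (volume_forall_mem _ fun i => (measurableSet_shells _ _ _).inter measurableSet_Ioo).symm
    _ ≤ _ := by
        refine measure_mono fun y hy => ⟨fun i => (hy i).1, ?_⟩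
        rw [Metric.mem_ball, dist_eq_norm]
        calc ‖y - x‖ ≤ ∑ i, |(y - x) i| := norm_le_sum_abs _
          _ < ∑ _i : Fin d, r / d := by
            refine Finset.sum_lt_sum_of_nonempty Finset.univ_nonempty fun i _ => ?_
            rw [PiLp.sub_apply, abs_lt]
            constructor <;> linarith [(hy i).2.1, (hy i).2.2]
          _ = r := by simp; field_simp

/-- The uniform distribution on the set of cubes. -/
def unifCells (d M : ℕ) (s : ℝ) : Measure (Feature d) :=
  (ENNReal.ofReal ((2 * s * M) ^ d))⁻¹ • volume.restrict (cells d M s (10 * d * s))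

theorem isProbabilityMeasure_unifCells (hd : 1 ≤ d) {s : ℝ} (hs : 0 < s) (hM : 1 ≤ s * M) :
    IsProbabilityMeasure (unifCells d M s) := by
  constructor
  rw [unifCells, Measure.smul_apply, Measure.restrict_apply_univ, volume_cells hd hs, smul_eq_mul,
    ENNReal.inv_mul_cancel _ ENNReal.ofReal_ne_top]
  have : 0 < 2 * s * M := by nlinarith
  exact (ENNReal.ofReal_pos.2 (by positivity)).ne'

theorem unifCells_cell {s : ℝ} (hs : 0 < s) (hM : 1 ≤ s * M) (k : Fin d → Fin M) :
    unifCells d M s (cell s (10 * d * s) k) = ENNReal.ofReal (((M : ℝ) ^ d)⁻¹) := by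
  have hM0 : (0 : ℝ) < M := pos_of_mul_pos_right (by linarith) hs.le
  rw [unifCells, Measure.smul_apply, Measure.restrict_apply (isClosed_cell _ _ k).measurableSet,
    Set.inter_eq_left.2 (cell_subset_cells _ _ k), volume_cell hs, smul_eq_mul,
    ← ENNReal.ofReal_inv_of_pos (by positivity), ← ENNReal.ofReal_mul (by positivity)]
  congr 1
  rw [mul_pow (2 * s)]
  field_simp

theorem unifCells_ball_site (hd : 1 ≤ d) {s : ℝ} (hs : 0 < s) (hM : 1 ≤ s * M)
    (k : Fin d → Fin M) :
    unifCells d M s (Metric.ball (site (10 * d * s) k) (5 * d * s))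
      = ENNReal.ofReal (((M : ℝ) ^ d)⁻¹) := by
  rw [← unifCells_cell hs hM k, unifCells, Measure.smul_apply, Measure.smul_apply,
    Measure.restrict_apply measurableSet_ball, Set.inter_comm, cells_inter_ball hd hs,
    Measure.restrict_apply (isClosed_cell _ _ k).measurableSet,
    Set.inter_eq_left.2 (cell_subset_cells _ _ k)]

theorem support_unifCells (hd : 1 ≤ d) {s : ℝ} (hs : 0 < s) (hM : 1 ≤ s * M) :
    (unifCells d M s).support = cells d M s (10 * d * s) := by
  refine Set.Subset.antisymm (Measure.support_subset_of_isClosed (isClosed_cells _ _) ?_) ?_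
  · rw [mem_ae_iff, unifCells, Measure.smul_apply,
      Measure.restrict_apply (isClosed_cells _ _).measurableSet.compl]
    simp
  · intro x hx
    rw [Measure.mem_support_iff_forall]
    intro V hV
    obtain ⟨ε, hε, hεV⟩ := Metric.mem_nhds_iff.1 hV
    have hr : 0 < min ε 1 := lt_min hε one_pos
    have h1 : 0 < volume.real (cells d M s (10 * d * s) ∩ Metric.ball x (min ε 1)) :=
      (mul_pos (regularityConst_pos hd) (volume_real_ball_pos x hr)).trans_le
        (regularity_cells hd hs hM hx hr (min_le_right _ _))
    have h2 : volume (cells d M s (10 * d * s) ∩ Metric.ball x (min ε 1)) ≠ 0 := fun h => by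
      simp [measureReal_def, h] at h1
    refine lt_of_lt_of_le ?_ (measure_mono ((Metric.ball_subset_ball (min_le_left ε 1)).trans hεV))
    rw [unifCells, Measure.smul_apply, Measure.restrict_apply measurableSet_ball, Set.inter_comm,
      smul_eq_mul]
    exact ENNReal.mul_pos (ENNReal.inv_ne_zero.2 ENNReal.ofReal_ne_top) h2

theorem exists_density_unifCells (hd : 1 ≤ d) {s : ℝ} (hs : 0 < s) (hM : 1 ≤ s * M)
    (hM2 : s * M ≤ 2) :
    ∃ f : Feature d → ℝ, Measurable f ∧
      unifCells d M s = volume.withDensity (fun x => ENNReal.ofReal (f x)) ∧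
      ∀ x ∈ (unifCells d M s).support, (1 / 4) ^ d ≤ f x ∧ f x ≤ (1 / 2) ^ d := by
  have hX := (isClosed_cells (d := d) (M := M) s (10 * d * s)).measurableSet
  refine ⟨(cells d M s (10 * d * s)).indicator fun _ => ((2 * s * M) ^ d)⁻¹,
    measurable_const.indicator hX, ?_, ?_⟩
  · have e : (fun x => ENNReal.ofReal ((cells d M s (10 * d * s)).indicator
        (fun _ => ((2 * s * M) ^ d)⁻¹) x))
        = (cells d M s (10 * d * s)).indicator fun _ => (ENNReal.ofReal ((2 * s * M) ^ d))⁻¹ := by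
      funext x
      by_cases hx : x ∈ cells d M s (10 * d * s)
      · have : 0 < 2 * s * M := by nlinarith
        simp only [Set.indicator_of_mem hx]
        rw [ENNReal.ofReal_inv_of_pos (by positivity)]
      · simp [hx]
    rw [e, withDensity_indicator hX, withDensity_const, unifCells]
  · intro x hx
    rw [support_unifCells hd hs hM] at hx
    rw [Set.indicator_of_mem hx, ← inv_pow]
    have h0 : 0 < 2 * s * M := by nlinarith
    constructor
    · gcongr
      rw [one_div]
      exact inv_anti₀ h0 (by linarith)
    · gcongr
      rw [one_div]
      exact inv_anti₀ (by norm_num) (by linarith)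

end Lattice

/-! ### The regression functions -/

section Regression

variable {d M : ℕ}

/-- The bump of size `s ^ α` around the site with index `k`. -/
def bump (α s : ℝ) (i : Fin d) (k : Fin d → Fin M) (x : Feature d) : ℝ :=
  s ^ α / (20 * d) * profile i (5 * d) (s⁻¹ • (x - site (10 * d * s) k))

/-- The sign that corresponds to a label. -/
def labelSign (b : Bool) : ℝ := if b then 1 else -1

theorem abs_labelSign (b : Bool) : |labelSign b| = 1 := by cases b <;> simp [labelSign]

theorem labelSign_not (b : Bool) : labelSign (!b) = -labelSign b := by
  cases b <;> simp [labelSign]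

/-- The regression function with bumps of signs `σ` around the sites in `J`. -/
def bumpRegression (α s : ℝ) (i : Fin d) (J : Finset (Fin d → Fin M))
    (σ : (Fin d → Fin M) → Bool) (x : Feature d) : ℝ :=
  1 / 2 + ∑ k ∈ J, labelSign (σ k) * bump α s i k x

variable {α s : ℝ} {i : Fin d} {J : Finset (Fin d → Fin M)} {σ : (Fin d → Fin M) → Bool}

theorem bump_eq_zero (hs : 0 < s) {k : Fin d → Fin M} {x : Feature d}
    (hx : x ∉ Metric.ball (site (10 * d * s) k) (5 * d * s)) : bump α s i k x = 0 := by
  rw [bump, profile_eq_zero, mul_zero]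
  rw [Metric.mem_ball, not_lt, dist_eq_norm] at hx
  rw [norm_smul, norm_inv, Real.norm_of_nonneg hs.le, inv_mul_eq_div, le_div_iff₀ hs]
  exact hx

theorem abs_bump_le (hd : 1 ≤ d) (hs : 0 < s) (k : Fin d → Fin M) (x : Feature d) :
    |bump α s i k x| ≤ s ^ α / 4 := by
  have hd' : (1 : ℝ) ≤ d := by exact_mod_cast hd
  have hsα : 0 < s ^ α := Real.rpow_pos_of_pos hs α
  have h : |profile i (5 * d) (s⁻¹ • (x - site (10 * d * s) k))| ≤ 5 * d :=
    (abs_profile_le _ _ _).trans (max_le (by linarith) (sub_le_self _ (norm_nonneg _)))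
  rw [bump, abs_mul, abs_of_pos (by positivity)]
  calc _ ≤ s ^ α / (20 * d) * (5 * d) := by gcongr
    _ = _ := by field_simp; norm_num

/-- At distances at least `s` the bound on the size suffices; below `s` the Lipschitz bound does,
because `q ≤ q ^ α` for `q = ‖x - y‖ / s ≤ 1`. The factor `1/2` leaves room for two points in
different bumps. -/
theorem abs_bump_sub_le (hd : 1 ≤ d) (hα0 : 0 < α) (hα1 : α ≤ 1) (hs : 0 < s)
    (k : Fin d → Fin M) (x y : Feature d) :
    |bump α s i k x - bump α s i k y| ≤ ‖x - y‖ ^ α / 2 := by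
  have hd' : (1 : ℝ) ≤ d := by exact_mod_cast hd
  have hsα : 0 < s ^ α := Real.rpow_pos_of_pos hs α
  rcases le_or_gt s ‖x - y‖ with h | h
  · have h1 := abs_bump_le (α := α) (i := i) hd hs k x
    have h2 := abs_bump_le (α := α) (i := i) hd hs k y
    have h3 : s ^ α ≤ ‖x - y‖ ^ α := Real.rpow_le_rpow hs.le h hα0.le
    have h4 := abs_sub (bump α s i k x) (bump α s i k y)
    linarith
  · have hlip := (lipschitzWith_profile i (5 * d)).dist_le_mul
      (s⁻¹ • (x - site (10 * d * s) k)) (s⁻¹ • (y - site (10 * d * s) k))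
    rw [Real.dist_eq, NNReal.coe_one, one_mul, dist_eq_norm, ← smul_sub, sub_sub_sub_cancel_right,
      norm_smul, norm_inv, Real.norm_of_nonneg hs.le, inv_mul_eq_div] at hlip
    rw [bump, bump, ← mul_sub, abs_mul, abs_of_pos (by positivity)]
    have hr0 := norm_nonneg (x - y)
    have h1 : s ^ α * (‖x - y‖ / s) ≤ ‖x - y‖ ^ α := by
      rcases hr0.eq_or_lt with h0 | h0
      · rw [← h0]
        simp [Real.zero_rpow hα0.ne']
      · have hq : ‖x - y‖ / s ≤ (‖x - y‖ / s) ^ α := by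
          conv_lhs => rw [← Real.rpow_one (‖x - y‖ / s)]
          exact Real.rpow_le_rpow_of_exponent_ge (by positivity) ((div_le_one hs).2 h.le) hα1
        rw [Real.div_rpow hr0 hs.le] at hq
        calc s ^ α * (‖x - y‖ / s) ≤ s ^ α * (‖x - y‖ ^ α / s ^ α) := by gcongr
          _ = _ := by field_simp
    calc s ^ α / (20 * d) * |profile i (5 * d) (s⁻¹ • (x - site (10 * d * s) k))
          - profile i (5 * d) (s⁻¹ • (y - site (10 * d * s) k))|
        ≤ s ^ α / (20 * d) * (‖x - y‖ / s) := by gcongr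
      _ = s ^ α * (‖x - y‖ / s) / (20 * d) := by ring
      _ ≤ ‖x - y‖ ^ α / 2 := by
        gcongr
        linarith

/-- Each sum has at most one nonzero term, so at most two indices matter. This makes the Hölder
constant independent of the number of bumps. -/
theorem abs_sum_sub_sum_le_two_mul {ι : Type*} [DecidableEq ι] (J : Finset ι) (f g : ι → ℝ) {δ : ℝ}
    (hf : ∀ j ∈ J, ∀ k ∈ J, f j ≠ 0 → f k ≠ 0 → j = k)
    (hg : ∀ j ∈ J, ∀ k ∈ J, g j ≠ 0 → g k ≠ 0 → j = k) (hδ : 0 ≤ δ)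
    (h : ∀ j ∈ J, |f j - g j| ≤ δ) : |∑ j ∈ J, f j - ∑ j ∈ J, g j| ≤ 2 * δ := by
  classical
  set A := J.filter fun j => f j ≠ 0
  set B := J.filter fun j => g j ≠ 0
  have hA : A.card ≤ 1 := Finset.card_le_one.2 fun a ha b hb => by
    rw [Finset.mem_filter] at ha hb
    exact hf a ha.1 b hb.1 ha.2 hb.2
  have hB : B.card ≤ 1 := Finset.card_le_one.2 fun a ha b hb => by
    rw [Finset.mem_filter] at ha hb
    exact hg a ha.1 b hb.1 ha.2 hb.2
  have hsub : A ∪ B ⊆ J := Finset.union_subset (Finset.filter_subset _ _) (Finset.filter_subset _ _)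
  rw [← Finset.sum_sub_distrib, ← Finset.sum_subset hsub]
  · calc _ ≤ ∑ j ∈ A ∪ B, |f j - g j| := Finset.abs_sum_le_sum_abs _ _
      _ ≤ ∑ _j ∈ A ∪ B, δ := Finset.sum_le_sum fun j hj => h j (hsub hj)
      _ = (A ∪ B).card * δ := by simp
      _ ≤ 2 * δ := by
        gcongr
        exact_mod_cast (Finset.card_union_le A B).trans (by omega)
  · intro j hj hn
    simp only [A, B, Finset.mem_union, Finset.mem_filter, not_or, not_and, not_not] at hn
    rw [hn.1 hj, hn.2 hj, sub_zero]

theorem bumpRegression_of_mem_ball (hs : 0 < s) {k : Fin d → Fin M} {x : Feature d}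
    (hx : x ∈ Metric.ball (site (10 * d * s) k) (5 * d * s)) :
    bumpRegression α s i J σ x
      = 1 / 2 + if k ∈ J then labelSign (σ k) * bump α s i k x else 0 := by
  rw [bumpRegression]
  congr 1
  have h0 : ∀ j, j ≠ k → labelSign (σ j) * bump α s i j x = 0 := fun j hj => by
    rw [bump_eq_zero hs fun h => Set.disjoint_left.1 (disjoint_ball_site hs hj) h hx, mul_zero]
  split_ifs with hk
  · exact Finset.sum_eq_single_of_mem k hk fun j _ hj => h0 j hj
  · exact Finset.sum_eq_zero fun j hj => h0 j fun h => hk (h ▸ hj)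

theorem bumpRegression_update_of_notMem [DecidableEq (Fin d → Fin M)] (hs : 0 < s)
    {k : Fin d → Fin M} {x : Feature d} (b : Bool)
    (hx : x ∉ Metric.ball (site (10 * d * s) k) (5 * d * s)) :
    bumpRegression α s i J σ x = bumpRegression α s i J (Function.update σ k b) x := by
  rw [bumpRegression, bumpRegression]
  congr 1
  refine Finset.sum_congr rfl fun j _ => ?_
  by_cases hj : j = k
  · subst hj
    rw [bump_eq_zero hs hx, mul_zero, mul_zero]
  · rw [Function.update_of_ne hj]

theorem bumpRegression_add_update [DecidableEq (Fin d → Fin M)] (hs : 0 < s)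
    {k : Fin d → Fin M} {x : Feature d}
    (hx : x ∈ Metric.ball (site (10 * d * s) k) (5 * d * s)) :
    bumpRegression α s i J σ x + bumpRegression α s i J (Function.update σ k (!σ k)) x = 1 := by
  rw [bumpRegression_of_mem_ball hs hx, bumpRegression_of_mem_ball hs hx, Function.update_self,
    labelSign_not]
  split_ifs <;> ring

theorem abs_bumpRegression_sub_half_le (hd : 1 ≤ d) (hs : 0 < s) (x : Feature d) :
    |bumpRegression α s i J σ x - 1 / 2| ≤ s ^ α / 4 := by
  have hsα : 0 < s ^ α := Real.rpow_pos_of_pos hs α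
  by_cases hx : ∃ k : Fin d → Fin M, x ∈ Metric.ball (site (10 * d * s) k) (5 * d * s)
  · obtain ⟨k, hk⟩ := hx
    rw [bumpRegression_of_mem_ball hs hk, add_sub_cancel_left]
    split_ifs
    · rw [abs_mul, abs_labelSign, one_mul]
      exact abs_bump_le hd hs k x
    · rw [abs_zero]
      positivity
  · push Not at hx
    rw [bumpRegression, add_sub_cancel_left, Finset.sum_eq_zero fun k _ => by
      rw [bump_eq_zero hs (hx k), mul_zero], abs_zero]
    positivity

theorem bumpRegression_mem_Icc (hd : 1 ≤ d) (hα0 : 0 < α) (hs : 0 < s) (hs1 : s ≤ 1)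
    (x : Feature d) : 0 ≤ bumpRegression α s i J σ x ∧ bumpRegression α s i J σ x ≤ 1 := by
  have h1 := abs_le.1 (abs_bumpRegression_sub_half_le (α := α) (i := i) (J := J) (σ := σ) hd hs x)
  have h2 : s ^ α ≤ 1 := Real.rpow_le_one hs.le hs1 hα0.le
  constructor <;> linarith

theorem measurable_bumpRegression : Measurable (bumpRegression α s i J σ) := by
  have h := (lipschitzWith_profile i (5 * (d : ℝ))).continuous.measurable
  unfold bumpRegression bump
  refine measurable_const.add (Finset.measurable_sum _ fun k _ => ?_)
  refine (measurable_const.mul (h.comp ?_)).const_mul _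
  fun_prop

theorem abs_bumpRegression_sub_le (hd : 1 ≤ d) (hα0 : 0 < α) (hα1 : α ≤ 1) (hs : 0 < s)
    (x y : Feature d) :
    |bumpRegression α s i J σ x - bumpRegression α s i J σ y| ≤ ‖x - y‖ ^ α := by
  classical
  have hz : ∀ z : Feature d, ∀ j ∈ J, ∀ k ∈ J, labelSign (σ j) * bump α s i j z ≠ 0 →
      labelSign (σ k) * bump α s i k z ≠ 0 → j = k := by
    intro z j _ k _ hj hk
    by_contra hjk
    have h1 : z ∈ Metric.ball (site (10 * d * s) j) (5 * d * s) := by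
      by_contra h
      exact hj (by rw [bump_eq_zero hs h, mul_zero])
    have h2 : z ∈ Metric.ball (site (10 * d * s) k) (5 * d * s) := by
      by_contra h
      exact hk (by rw [bump_eq_zero hs h, mul_zero])
    exact Set.disjoint_left.1 (disjoint_ball_site hs hjk) h1 h2
  have h := abs_sum_sub_sum_le_two_mul J (fun k => labelSign (σ k) * bump α s i k x)
    (fun k => labelSign (σ k) * bump α s i k y) (hz x) (hz y) (δ := ‖x - y‖ ^ α / 2)
    (by positivity) fun k _ => by
      rw [← mul_sub, abs_mul, abs_labelSign, one_mul]
      exact abs_bump_sub_le hd hα0 hα1 hs k x y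
  rw [bumpRegression, bumpRegression, add_sub_add_left_eq_sub]
  linarith

/-- Around the cubes of an active cell the regression function is affine. -/
theorem bumpRegression_eq_affine (hd : 1 ≤ d) (hs : 0 < s) {k : Fin d → Fin M} (hk : k ∈ J)
    {x w : Feature d} (hx : x ∈ cell s (10 * d * s) k) (hw : w ∈ Metric.closedBall x s) :
    bumpRegression α s i J σ w
      = 1 / 2 + labelSign (σ k) * (s ^ α / (20 * d * s)) * (w i - site (10 * d * s) k i) := by
  have hd' : (1 : ℝ) ≤ d := by exact_mod_cast hd
  -- The cell has radius at most `3ds/2` and `s ≤ ds`, so `w` stays in the inner half of the bump,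
  -- where the profile is not truncated.
  have h1 : dist w (site (10 * d * s) k) ≤ 5 * d * s / 2 := by
    have := dist_triangle w x (site (10 * d * s) k)
    have h2 := dist_site_le hx
    rw [Metric.mem_closedBall] at hw
    nlinarith
  rw [bumpRegression_of_mem_ball hs (Metric.mem_ball.2 (h1.trans_lt (half_lt_self (by positivity)))),
    if_pos hk, bump, profile_eq_apply]
  · simp only [PiLp.smul_apply, PiLp.sub_apply, smul_eq_mul]
    field_simp
  · rw [norm_smul, norm_inv, Real.norm_of_nonneg hs.le, ← dist_eq_norm, inv_mul_eq_div]
    rw [← mul_div_assoc, div_le_iff₀ hs]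
    linarith

theorem le_abs_bumpRegression_sub_half (hd : 1 ≤ d) (hs : 0 < s) {k : Fin d → Fin M} (hk : k ∈ J)
    {x : Feature d} (hx : x ∈ cell s (10 * d * s) k) :
    s ^ α / (40 * d) ≤ |bumpRegression α s i J σ x - 1 / 2| := by
  have hd' : (1 : ℝ) ≤ d := by exact_mod_cast hd
  have hsα : 0 < s ^ α := Real.rpow_pos_of_pos hs α
  rw [bumpRegression_eq_affine hd hs hk hx (Metric.mem_closedBall_self hs.le), add_sub_cancel_left,
    abs_mul, abs_mul, abs_labelSign, one_mul, abs_of_pos (by positivity)]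
  calc s ^ α / (40 * d) = s ^ α / (20 * d * s) * (s / 2) := by field_simp; norm_num
    _ ≤ _ := by
      gcongr
      exact (hx i).1

theorem bumpRegression_eq_half (hd : 1 ≤ d) (hs : 0 < s) {k : Fin d → Fin M} (hk : k ∉ J)
    {x : Feature d} (hx : x ∈ cell s (10 * d * s) k) : bumpRegression α s i J σ x = 1 / 2 := by
  rw [bumpRegression_of_mem_ball hs (cell_subset_ball hd hs k hx), if_neg hk, add_zero]

end Regression

/-! ### The models satisfy the assumptions -/

section Models

variable {d M : ℕ} {α s : ℝ} {i : Fin d} {J : Finset (Fin d → Fin M)}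
  {σ : (Fin d → Fin M) → Bool}

/-- The constants for which the models satisfy the assumptions with margin exponent `β`. -/
def modelConstants (hd : 1 ≤ d) (β : ℝ) : Constants where
  c₀ := regularityConst d
  r₀ := 1
  B := (40 * d) ^ β
  cr := 1
  fmin := (1 / 4) ^ d
  fmax := (1 / 2) ^ d
  c₀_pos := regularityConst_pos hd
  r₀_pos := one_pos
  B_pos := Real.rpow_pos_of_pos (by have : 0 < d := hd; positivity) β
  cr_pos := one_pos
  fmin_pos := by positivity
  fmax_pos := by positivity

/-- The model with regression function `bumpRegression` and uniform distribution on the cubes. -/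
def bumpModel (α s : ℝ) (i : Fin d) (J : Finset (Fin d → Fin M)) (σ : (Fin d → Fin M) → Bool) :
    Model d :=
  (labelledLaw (unifCells d M s) (bumpRegression α s i J σ), bumpRegression α s i J σ)

theorem unifCells_compl_cells (s : ℝ) : unifCells d M s (cells d M s (10 * d * s))ᶜ = 0 := by
  rw [unifCells, Measure.smul_apply,
    Measure.restrict_apply (isClosed_cells _ _).measurableSet.compl]
  simp

theorem unifCells_margin_eq_zero (hd : 1 ≤ d) (hs : 0 < s) {t : ℝ} (ht : t ≤ s ^ α / (40 * d)) :
    unifCells d M s {x | 0 < |bumpRegression α s i J σ x - 1 / 2|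
      ∧ |bumpRegression α s i J σ x - 1 / 2| < t} = 0 := by
  refine measure_mono_null (fun x hx => ?_) (unifCells_compl_cells s)
  rw [Set.mem_compl_iff]
  intro hxc
  obtain ⟨k, hk⟩ := Set.mem_iUnion.1 hxc
  by_cases hkJ : k ∈ J
  · exact absurd (hx.2.trans_le ht) (not_lt.2 (le_abs_bumpRegression_sub_half hd hs hkJ hk))
  · have := hx.1
    rw [bumpRegression_eq_half hd hs hkJ hk] at this
    simp at this

theorem unifCells_margin_le (hd : 1 ≤ d) (hs : 0 < s) (hM : 1 ≤ s * M) (t : ℝ) :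
    (unifCells d M s).real {x | 0 < |bumpRegression α s i J σ x - 1 / 2|
      ∧ |bumpRegression α s i J σ x - 1 / 2| < t} ≤ J.card * ((M : ℝ) ^ d)⁻¹ := by
  have := isProbabilityMeasure_unifCells (d := d) hd hs hM
  have hsub : {x | 0 < |bumpRegression α s i J σ x - 1 / 2|
      ∧ |bumpRegression α s i J σ x - 1 / 2| < t}
      ⊆ (⋃ k ∈ J, cell s (10 * d * s) k) ∪ (cells d M s (10 * d * s))ᶜ := by
    intro x hx
    by_cases hxc : x ∈ cells d M s (10 * d * s)
    · obtain ⟨k, hk⟩ := Set.mem_iUnion.1 hxc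
      by_cases hkJ : k ∈ J
      · exact Or.inl (Set.mem_iUnion₂.2 ⟨k, hkJ, hk⟩)
      · have := hx.1
        rw [bumpRegression_eq_half hd hs hkJ hk] at this
        simp at this
    · exact Or.inr hxc
  calc _ ≤ (unifCells d M s).real ((⋃ k ∈ J, cell s (10 * d * s) k)
        ∪ (cells d M s (10 * d * s))ᶜ) := measureReal_mono hsub
    _ ≤ (unifCells d M s).real (⋃ k ∈ J, cell s (10 * d * s) k)
        + (unifCells d M s).real (cells d M s (10 * d * s))ᶜ := measureReal_union_le _ _
    _ ≤ ∑ k ∈ J, (unifCells d M s).real (cell s (10 * d * s) k) + 0 := by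
        gcongr
        · exact measureReal_biUnion_finset_le _ _
        · rw [measureReal_def, unifCells_compl_cells, ENNReal.toReal_zero]
    _ = _ := by
        simp only [measureReal_def, unifCells_cell hs hM]
        rw [ENNReal.toReal_ofReal (by positivity)]
        simp

/-- The margin condition has two regimes. Below the gap `s ^ α / (40 * d)` the event is null; above
it the event has at most the mass of the active cells, and `s ^ (α * β) ≤ (40 * d * t) ^ β` yields
the constant `B`. -/
theorem satisfies_bumpModel (hd : 1 ≤ d) (hα0 : 0 < α) (hα1 : α ≤ 1) {β : ℝ} (hβ : 0 < β)
    (hs : 0 < s) (hs1 : s ≤ 1) (hM : 1 ≤ s * M) (hM2 : s * M ≤ 2)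
    (hJ : J.card * ((M : ℝ) ^ d)⁻¹ ≤ s ^ (α * β)) :
    Satisfies α β (modelConstants hd β) (bumpModel α s i J σ).1 (bumpModel α s i J σ).2 := by
  have hμ := isProbabilityMeasure_unifCells (d := d) hd hs hM
  have hm := measurable_bumpRegression (α := α) (s := s) (i := i) (J := J) (σ := σ)
  have h01 := bumpRegression_mem_Icc (α := α) (i := i) (J := J) (σ := σ) hd hα0 hs hs1
  have hfst : (bumpModel α s i J σ).1.fst = unifCells d M s :=
    fst_labelledLaw _ hm (fun x => (h01 x).1) fun x => (h01 x).2
  have hd' : (1 : ℝ) ≤ d := by exact_mod_cast hd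
  refine ⟨isProbabilityMeasure_labelledLaw _ hm (fun x => (h01 x).1) fun x => (h01 x).2,
    isRegressionFunction_labelledLaw _ hm (fun x => (h01 x).1) fun x => (h01 x).2,
    ?_, ?_, ?_, ?_, ?_⟩
  · rw [hfst, support_unifCells hd hs hM]
    exact fun x hx r hr hr1 => regularity_cells hd hs hM hx hr hr1
  · rw [hfst, support_unifCells hd hs hM]
    exact isCompact_cells _ _
  · intro t ht
    rw [hfst]
    rcases le_or_gt t (s ^ α / (40 * d)) with h | h
    · rw [measureReal_def, bumpModel, unifCells_margin_eq_zero hd hs h, ENNReal.toReal_zero]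
      exact mul_nonneg (modelConstants hd β).B_pos.le (by positivity)
    · refine (unifCells_margin_le hd hs hM t).trans (hJ.trans ?_)
      have hsα : 0 < s ^ α := Real.rpow_pos_of_pos hs α
      calc s ^ (α * β) = (s ^ α) ^ β := Real.rpow_mul hs.le α β
        _ ≤ (40 * d * t) ^ β := by
          refine Real.rpow_le_rpow hsα.le ?_ hβ.le
          rw [div_lt_iff₀ (by positivity)] at h
          linarith
        _ = (40 * d) ^ β * t ^ β := Real.mul_rpow (by positivity) ht.le
  · intro x r _
    have h := abs_bumpRegression_sub_le (i := i) (J := J) (σ := σ) hd hα0 hα1 hs (x + r) x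
    rwa [add_sub_cancel_left] at h
  · rw [hfst]
    exact exists_density_unifCells hd hs hM hM2

/-- If `|η(X) - 1/2|` is bounded away from zero where it does not vanish, then the margin condition
holds with any exponent. -/
theorem Satisfies.mem_distClass {β β' : ℝ} (hβ' : 0 < β') {κ : Constants} {P : Measure (Obs d)}
    {η : Feature d → ℝ} (h : Satisfies α β κ P η) {a : ℝ} (ha : 0 < a)
    (hη : P.fst {x | 0 < |η x - 1 / 2| ∧ |η x - 1 / 2| < a} = 0) :
    (P, η) ∈ distClass d α β' := by
  have := h.isProbabilityMeasure
  refine ⟨{ κ with B := a⁻¹ ^ β', B_pos := by positivity }, h.isProbabilityMeasure,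
    h.isRegressionFunction, h.regular, h.compact, ?_, h.smooth, h.density⟩
  intro t ht
  rw [← Real.mul_rpow (by positivity) ht.le]
  rcases le_or_gt t a with hta | hta
  · have h0 : P.fst {x | 0 < |η x - 1 / 2| ∧ |η x - 1 / 2| < t} = 0 :=
      measure_mono_null (fun x hx => And.intro hx.1 (hx.2.trans_le hta)) hη
    rw [measureReal_def, h0, ENNReal.toReal_zero]
    positivity
  · refine measureReal_le_one.trans (Real.one_le_rpow ?_ hβ'.le)
    rw [inv_mul_eq_div, one_le_div ha]
    exact hta.le

end Models

/-! ### The minimax lower bound -/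

section Minimax

variable {d n : ℕ} {α β : ℝ}

theorem excessRisk_le_one (μ : Measure (Feature d)) [IsProbabilityMeasure μ] {η : Feature d → ℝ}
    (hη : Measurable η) (h0 : ∀ x, 0 ≤ η x) (h1 : ∀ x, η x ≤ 1)
    (K : Kernel (Feature d) (Feature d)) [IsMarkovKernel K] (g : Classifier d n) :
    excessRisk μ η K g ≤ 1 := by
  have := isProbabilityMeasure_labelledLaw μ hη h0 h1
  calc excessRisk μ η K g ≤ ∫⁻ _, 1 ∂μ := by
        refine lintegral_mono fun x => mul_le_one' ?_ ?_
        · rw [ENNReal.ofReal_le_one, abs_le]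
          constructor <;> linarith [h0 x, h1 x]
        · calc _ ≤ ∫⁻ _, 1 ∂K x := lintegral_mono fun z => prob_le_one
            _ = 1 := by simp
    _ = 1 := by simp

/-- `J` has `⌊M ^ d * s ^ (α * β)⌋` elements. From `α * β ≤ d` this product is at least `(s * M) ^ d
≥ 1`, so rounding down loses at most a factor 2. -/
theorem exists_active_cells (hα0 : 0 < α) (hβ : 0 < β) (hαβ : α * β ≤ d) {s : ℝ} (hs : 0 < s)
    (hs1 : s ≤ 1) :
    ∃ (M : ℕ) (J : Finset (Fin d → Fin M)), 1 ≤ s * M ∧ s * M ≤ 2 ∧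
      J.card * ((M : ℝ) ^ d)⁻¹ ≤ s ^ (α * β) ∧ s ^ (α * β) / 2 ≤ J.card * ((M : ℝ) ^ d)⁻¹ := by
  set M := ⌈1 / s⌉₊
  have h1 : 1 ≤ s * M := by
    have := Nat.le_ceil (1 / s)
    rwa [div_le_iff₀ hs, mul_comm] at this
  have h2 : s * M ≤ 2 := by
    have := (Nat.ceil_lt_add_one (one_div_nonneg.2 hs.le)).le
    calc s * M ≤ s * (1 / s + 1) := by gcongr
      _ = 1 + s := by field_simp
      _ ≤ 2 := by linarith
  have hM0 : (0 : ℝ) < M := pos_of_mul_pos_right (by linarith) hs.le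
  have hN : (0 : ℝ) < (M : ℝ) ^ d := by positivity
  have hr : 0 < s ^ (α * β) := Real.rpow_pos_of_pos hs _
  have hr1 : s ^ (α * β) ≤ 1 := Real.rpow_le_one hs.le hs1 (by positivity)
  have hge : 1 ≤ (M : ℝ) ^ d * s ^ (α * β) := by
    calc (1 : ℝ) ≤ (s * M) ^ d := one_le_pow₀ h1
      _ = (M : ℝ) ^ d * s ^ (d : ℝ) := by rw [mul_pow, Real.rpow_natCast, mul_comm]
      _ ≤ _ := by
        gcongr ?_ * ?_
        exact Real.rpow_le_rpow_of_exponent_ge hs hs1 hαβ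
  set m := ⌊(M : ℝ) ^ d * s ^ (α * β)⌋₊
  have hm1 : (m : ℝ) ≤ (M : ℝ) ^ d * s ^ (α * β) := Nat.floor_le (by positivity)
  have hm2 : (M : ℝ) ^ d * s ^ (α * β) / 2 ≤ m := by
    have h3 := Nat.lt_floor_add_one ((M : ℝ) ^ d * s ^ (α * β))
    have h4 : (1 : ℝ) ≤ m := Nat.one_le_cast.2 ((Nat.one_le_floor_iff _).2 hge)
    linarith
  have hcard : m ≤ (Finset.univ : Finset (Fin d → Fin M)).card := by
    have : (m : ℝ) ≤ (M ^ d : ℕ) := by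
      push_cast
      nlinarith
    simpa using (by exact_mod_cast this : m ≤ M ^ d)
  obtain ⟨J, -, hJ⟩ := Finset.exists_subset_card_eq hcard
  refine ⟨M, J, h1, h2, ?_, ?_⟩
  · rw [hJ, ← div_eq_mul_inv, div_le_iff₀ hN]
    linarith
  · rw [hJ, ← div_eq_mul_inv, le_div_iff₀ hN]
    linarith

/-- The models of `distClassWith d α β κ` that satisfy the margin condition with any exponent. -/
def strongMarginClass (d : ℕ) (α β : ℝ) (κ : Constants) : Set (Model d) :=
  {p | p ∈ distClassWith d α β κ ∧ ∀ β' : ℝ, 0 < β' → p ∈ distClass d α β'}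

theorem bumpModel_mem_strongMarginClass {M : ℕ} (hd : 1 ≤ d) (hα0 : 0 < α) (hα1 : α ≤ 1)
    (hβ : 0 < β) {s : ℝ} (hs : 0 < s) (hs1 : s ≤ 1) (hM : 1 ≤ s * M) (hM2 : s * M ≤ 2) (i : Fin d)
    {J : Finset (Fin d → Fin M)} (hJ : J.card * ((M : ℝ) ^ d)⁻¹ ≤ s ^ (α * β))
    (σ : (Fin d → Fin M) → Bool) :
    bumpModel α s i J σ ∈ strongMarginClass d α β (modelConstants hd β) := by
  have h := satisfies_bumpModel (i := i) (σ := σ) hd hα0 hα1 hβ hs hs1 hM hM2 hJ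
  have h01 := bumpRegression_mem_Icc (α := α) (i := i) (J := J) (σ := σ) hd hα0 hs hs1
  have hμ := isProbabilityMeasure_unifCells (d := d) hd hs hM
  have hd' : (0 : ℝ) < d := by exact_mod_cast hd
  have hsα : 0 < s ^ α := Real.rpow_pos_of_pos hs α
  refine ⟨h, fun β' hβ' => h.mem_distClass hβ' (a := s ^ α / (40 * d)) (by positivity) ?_⟩
  rw [bumpModel, fst_labelledLaw _ measurable_bumpRegression (fun x => (h01 x).1)
    fun x => (h01 x).2]
  exact unifCells_margin_eq_zero hd hs le_rfl

/-- The sign `σ k` enters only the slope of `η`, which the conclusion does not involve: the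
perturbed point does not reveal it. -/
theorem PushesTowards.bumpModel_apply {M : ℕ} (hd : 1 ≤ d) {s : ℝ} (hs : 0 < s) {i : Fin d}
    {J : Finset (Fin d → Fin M)} {σ : (Fin d → Fin M) → Bool} {ρ : Measure (Feature d)} {ω : ℝ}
    (hωs : ω ≤ s) {K : Kernel (Feature d) (Feature d)}
    (hK : PushesTowards i ρ ω (bumpModel α s i J σ).2 K)
    {k : Fin d → Fin M} (hk : k ∈ J) {x : Feature d} (hx : x ∈ cell s (10 * d * s) k) :
    (site (10 * d * s) k i < x i → K x = ρ.map fun u => x - ω • u) ∧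
      (x i < site (10 * d * s) k i → K x = ρ.map fun u => x + ω • u) := by
  have hd' : (0 : ℝ) < d := by exact_mod_cast hd
  have hsα : 0 < s ^ α := Real.rpow_pos_of_pos hs α
  have hc : labelSign (σ k) * (s ^ α / (20 * d * s)) ≠ 0 := by
    refine mul_ne_zero (fun h => ?_) (by positivity)
    have := abs_labelSign (σ k)
    simp [h] at this
  have hlin : ∀ w ∈ Metric.closedBall x ω, (bumpModel α s i J σ).2 w
      = 1 / 2 + labelSign (σ k) * (s ^ α / (20 * d * s)) * (w i - site (10 * d * s) k i) :=
    fun w hw => bumpRegression_eq_affine hd hs hk hx (Metric.closedBall_subset_closedBall hωs hw)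
  exact ⟨hK.eq_map_sub x _ _ hc hlin, hK.eq_map_add x _ _ hc hlin⟩

theorem rpow_mul_add_one {s : ℝ} (hs : 0 < s) : s ^ (α * (β + 1)) = s ^ (α * β) * s ^ α := by
  rw [← Real.rpow_add hs]
  congr 1
  ring

variable {g : Classifier d n}

/-- The lower bound for small perturbations: the signs of the bumps cannot be learned. -/
theorem exists_regret_ge_of_small_sample (hd : 1 ≤ d) (hα0 : 0 < α) (hα1 : α ≤ 1) (hβ : 0 < β)
    (hαβ : α * β ≤ d) {s : ℝ} (hs : 0 < s) (hs1 : s ≤ 1) (hn : n * s ^ (2 * α + d) ≤ 1)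
    {ω : ℝ} (hωs : ω ≤ s) (hg : Measurable g) (i : Fin d) (ρ : Measure (Feature d))
    (K : Model d → Kernel (Feature d) (Feature d))
    (hK : ∀ p ∈ strongMarginClass d α β (modelConstants hd β), PushesTowards i ρ ω p.2 (K p)) :
    ∃ p ∈ strongMarginClass d α β (modelConstants hd β),
      1 / (640 * d) * s ^ (α * (β + 1)) ≤ testError p.1 (K p) g - bayesError p.1 p.2 := by
  classical
  obtain ⟨M, J, hM, hM2, hJ, hJ2⟩ := exists_active_cells hα0 hβ hαβ hs hs1
  have hmem := bumpModel_mem_strongMarginClass hd hα0 hα1 hβ hs hs1 hM hM2 i hJ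
  have hμ := isProbabilityMeasure_unifCells (d := d) hd hs hM
  have h01 := fun σ => bumpRegression_mem_Icc (α := α) (i := i) (J := J) (σ := σ) hd hα0 hs hs1
  have hm := fun σ => measurable_bumpRegression (α := α) (s := s) (i := i) (J := J) (σ := σ)
  have hMk : ∀ σ, IsMarkovKernel (K (bumpModel α s i J σ)) := fun σ =>
    (hK _ (hmem σ)).isMarkovKernel
  have hd' : (0 : ℝ) < d := by exact_mod_cast hd
  have hsα : 0 < s ^ α := Real.rpow_pos_of_pos hs α
  have hsα1 : s ^ α ≤ 1 := Real.rpow_le_one hs.le hs1 hα0.le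
  have hM0 : (0 : ℝ) < M := pos_of_mul_pos_right (by linarith) hs.le
  have hMs : ((M : ℝ) ^ d)⁻¹ ≤ s ^ d := by
    rw [inv_le_iff_one_le_mul₀ (by positivity), ← mul_pow]
    exact one_le_pow₀ hM
  obtain ⟨σ, hσ⟩ := exists_le_excessRisk_of_hypercube (unifCells d M s)
    (η := fun σ => bumpRegression α s i J σ) hm (fun σ x => (h01 σ x).1) (fun σ x => (h01 σ x).2)
    (fun σ => K (bumpModel α s i J σ)) hg J
    (U := fun k => Metric.ball (site (10 * d * s) k) (5 * d * s))
    (Q := fun k => cell s (10 * d * s) k)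
    (fun k => measurableSet_ball) (fun k => (isClosed_cell _ _ k).measurableSet)
    (fun k _ k' _ hkk => disjoint_cell hd hs hkk) (fun k => cell_subset_ball hd hs k)
    (fun σ k _ x hx => bumpRegression_update_of_notMem hs _ hx)
    (fun σ k _ x hx => bumpRegression_add_update hs hx)
    (a := s ^ α / 4) (by positivity) (by linarith)
    (fun σ k _ x _ => abs_bumpRegression_sub_half_le hd hs x)
    -- Each cell has mass at most `s ^ d`, so the information on one sign is at most `n * s ^ (2 * α
    -- + d) / 4`.
    (by
      intro k _
      rw [measureReal_def, unifCells_ball_site hd hs hM, ENNReal.toReal_ofReal (by positivity)]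
      have e : s ^ (2 * α + d) = (s ^ α) ^ 2 * s ^ d := by
        rw [Real.rpow_add hs, Real.rpow_natCast, mul_comm 2 α, Real.rpow_mul hs.le,
          Real.rpow_ofNat]
      rw [e] at hn
      calc (n : ℝ) * (4 * (s ^ α / 4) ^ 2 * ((M : ℝ) ^ d)⁻¹)
          ≤ n * (4 * (s ^ α / 4) ^ 2 * s ^ d) := by gcongr
        _ = n * ((s ^ α) ^ 2 * s ^ d) / 4 := by ring
        _ ≤ 1 / 2 := by linarith)
    (b := s ^ α / (20 * d)) (by positivity)
    (fun σ k hk x hx => by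
      have h := le_abs_bumpRegression_sub_half (α := α) (i := i) (σ := σ) hd hs hk hx
      have e : 2 * bumpRegression α s i J σ x - 1 = 2 * (bumpRegression α s i J σ x - 1 / 2) := by
        ring
      rw [e, abs_mul, abs_two]
      calc s ^ α / (20 * d) = 2 * (s ^ α / (40 * d)) := by field_simp; norm_num
        _ ≤ _ := by gcongr)
    (fun σ k hk x hx => by
      have h1 := (hK _ (hmem σ)).bumpModel_apply hd hs hωs hk hx
      have h2 := (hK _ (hmem (Function.update σ k (!σ k)))).bumpModel_apply hd hs hωs hk hx
      have h3 : x i - site (10 * d * s) k i ≠ 0 := by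
        intro h0
        have := (hx i).1
        rw [← site_apply, h0, abs_zero] at this
        linarith
      rcases lt_or_gt_of_ne h3 with h | h
      · rw [h1.2 (by linarith), h2.2 (by linarith)]
      · rw [h1.1 (by linarith), h2.1 (by linarith)])
    (fun k _ => (unifCells_cell hs hM k).ge)
  refine ⟨_, hmem σ, ?_⟩
  have htop := ne_top_of_le_ne_top ENNReal.one_ne_top (excessRisk_le_one (unifCells d M s) (hm σ)
    (fun x => (h01 σ x).1) (fun x => (h01 σ x).2) (K (bumpModel α s i J σ)) g)
  have hreg : testError (bumpModel α s i J σ).1 (K (bumpModel α s i J σ)) g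
      - bayesError (bumpModel α s i J σ).1 (bumpModel α s i J σ).2
      = (excessRisk (unifCells d M s) (bumpRegression α s i J σ) (K (bumpModel α s i J σ)) g).toReal
    := testError_sub_bayesError _ (hm σ) (fun x => (h01 σ x).1) (fun x => (h01 σ x).2) _ hg
  rw [hreg]
  have hσ' := ENNReal.toReal_mono (ENNReal.mul_ne_top ENNReal.ofNat_ne_top htop) hσ
  simp only [ENNReal.toReal_mul, ENNReal.toReal_natCast, ENNReal.toReal_inv, ENNReal.toReal_ofNat]
    at hσ'
  rw [ENNReal.toReal_ofReal (by positivity), ENNReal.toReal_ofReal (by positivity)] at hσ'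
  rw [rpow_mul_add_one hs]
  have : s ^ (α * β) / 2 * (s ^ α / (20 * d) / 8)
      ≤ J.card * ((M : ℝ) ^ d)⁻¹ * (s ^ α / (20 * d) / 8) := by gcongr
  -- `640 = 2 · 20 · 8 · 2`: rounding of the number of active cells, the lower bound on `|2η - 1|`,
  -- the test error, and the averaging over pairs.
  calc 1 / (640 * d) * (s ^ (α * β) * s ^ α)
      = (s ^ (α * β) / 2 * (s ^ α / (20 * d) / 8)) / 2 := by field_simp; norm_num
    _ ≤ _ := by linarith

/-- The lower bound for large perturbations: the perturbed points of both classes coincide. -/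
theorem exists_regret_ge_of_large_perturbation (hd : 1 ≤ d) (hα0 : 0 < α) (hα1 : α ≤ 1)
    (hβ : 0 < β) (hαβ : α * β ≤ d) {ω : ℝ} (hω : 0 < ω) (hω1 : ω ≤ 1) (hg : Measurable g)
    (i : Fin d) (ρ : Measure (Feature d)) [IsProbabilityMeasure ρ] {δ : ℝ} (hδ : 0 < δ)
    (hρ : ENNReal.ofReal δ ≤ ρ (Metric.ball (EuclideanSpace.single i (1 : ℝ)) (1 / 8)))
    (K : Model d → Kernel (Feature d) (Feature d))
    (hK : ∀ p ∈ strongMarginClass d α β (modelConstants hd β), PushesTowards i ρ ω p.2 (K p)) :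
    ∃ p ∈ strongMarginClass d α β (modelConstants hd β),
      δ / (40 * d * 4 ^ d) * ω ^ (α * (β + 1)) ≤ testError p.1 (K p) g - bayesError p.1 p.2 := by
  classical
  obtain ⟨M, J, hM, hM2, hJ, hJ2⟩ := exists_active_cells hα0 hβ hαβ hω hω1
  set σ : (Fin d → Fin M) → Bool := fun _ => true
  have hmem := bumpModel_mem_strongMarginClass hd hα0 hα1 hβ hω hω1 hM hM2 i hJ σ
  have hμ := isProbabilityMeasure_unifCells (d := d) hd hω hM
  have h01 := bumpRegression_mem_Icc (α := α) (i := i) (J := J) (σ := σ) hd hα0 hω hω1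
  have hm := measurable_bumpRegression (α := α) (s := ω) (i := i) (J := J) (σ := σ)
  have hMk := (hK _ hmem).isMarkovKernel
  have hd' : (0 : ℝ) < d := by exact_mod_cast hd
  have hωα : 0 < ω ^ α := Real.rpow_pos_of_pos hω α
  have hM0 : (0 : ℝ) < M := pos_of_mul_pos_right (by linarith) hω.le
  set h : ℝ := 10 * d * ω with hh
  have hval : ∀ k ∈ J, ∀ x ∈ cell ω h k, bumpRegression α ω i J σ x
      = 1 / 2 + ω ^ α / (20 * d * ω) * (x i - site h k i) := by
    intro k hk x hx
    rw [bumpRegression_eq_affine hd hω hk hx (Metric.mem_closedBall_self hω.le)]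
    simp [σ, labelSign, hh]
  have hc : 0 < ω ^ α / (20 * d * ω) := by positivity
  have hcoord : Measurable fun x : Feature d => x i := by fun_prop
  -- Concentric half-size subcubes of the positive cubes. For `u` within `1/8` of the unit vector,
  -- `2ωu` shifts coordinate `i` by between `7ω/4` and `9ω/4` and every other one by less than
  -- `ω/4`, which lands within the shells on the opposite side.
  let Qs : (Fin d → Fin M) → Set (Feature d) := fun k =>
    {x | ∀ j, x j ∈ Set.Icc (h * ((k j : ℕ) : ℝ) + 3 * ω / 4) (h * ((k j : ℕ) : ℝ) + 5 * ω / 4)}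
  have hQsub : ∀ k, Qs k ⊆ cell ω h k ∩ {x | site h k i < x i} := by
    intro k x hx
    refine ⟨fun j => ?_, ?_⟩
    · have h1 := hx j
      have h2 : 0 ≤ x j - h * ((k j : ℕ) : ℝ) := by linarith [h1.1]
      refine ⟨?_, ?_⟩ <;> rw [abs_of_nonneg h2] <;> linarith [h1.1, h1.2]
    · change site h k i < x i
      rw [site_apply]
      linarith [(hx i).1]
  have hQvol : ∀ k, unifCells d M ω (Qs k) = ENNReal.ofReal (((4 * M : ℝ) ^ d)⁻¹) := by
    intro k
    have hv : volume (Qs k) = ENNReal.ofReal ((ω / 2) ^ d) := by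
      rw [volume_forall_mem _ fun j => measurableSet_Icc]
      simp only [Real.volume_Icc]
      rw [Finset.prod_congr rfl fun j _ => by
        rw [show h * ((k j : ℕ) : ℝ) + 5 * ω / 4 - (h * ((k j : ℕ) : ℝ) + 3 * ω / 4) = ω / 2 by ring]]
      rw [Finset.prod_const, Finset.card_univ, Fintype.card_fin, ENNReal.ofReal_pow (by positivity)]
    have hQm : MeasurableSet (Qs k) := measurableSet_forall_mem fun j => measurableSet_Icc
    rw [unifCells, Measure.smul_apply, Measure.restrict_apply hQm, Set.inter_eq_left.2
      (((hQsub k).trans Set.inter_subset_left).trans (cell_subset_cells _ _ k)), hv, smul_eq_mul,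
      ← ENNReal.ofReal_inv_of_pos (by positivity), ← ENNReal.ofReal_mul (by positivity)]
    congr 1
    rw [← inv_pow, ← inv_pow, ← mul_pow]
    congr 1
    field_simp
    norm_num
  have hμ' : IsProbabilityMeasure ((ENNReal.ofReal ((2 * ω * M) ^ d))⁻¹
      • volume.restrict (cells d M ω h) : Measure (Feature d)) := hμ
  have key := le_excessRisk_of_confusion (c := (ENNReal.ofReal ((2 * ω * M) ^ d))⁻¹)
    (X := cells d M ω h) (η := bumpRegression α ω i J σ) hm (fun x => (h01 x).1)
    (fun x => (h01 x).2) (K (bumpModel α ω i J σ)) hg J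
    (Qp := fun k => cell ω h k ∩ {x | site h k i < x i})
    (Qm := fun k => cell ω h k ∩ {x | x i < site h k i}) (Qs := Qs)
    (fun k => (isClosed_cell _ _ k).measurableSet.inter (measurableSet_lt measurable_const hcoord))
    (fun k => (isClosed_cell _ _ k).measurableSet.inter (measurableSet_lt hcoord measurable_const))
    (fun k => measurableSet_forall_mem fun j => measurableSet_Icc)
    hQsub
    (fun k => Set.inter_subset_left.trans (cell_subset_cells _ _ k))
    (fun k => Set.inter_subset_left.trans (cell_subset_cells _ _ k))
    (fun k _ k' _ hkk => (disjoint_cell hd hω hkk).mono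
      (Set.union_subset Set.inter_subset_left Set.inter_subset_left)
      (Set.union_subset Set.inter_subset_left Set.inter_subset_left))
    (b := ω ^ α / (20 * d))
    (fun k hk x hx => by
      have hx' : x ∈ cell ω h k := hx.elim And.left And.left
      have h := le_abs_bumpRegression_sub_half (α := α) (i := i) (σ := σ) hd hω hk hx'
      have e : 2 * bumpRegression α ω i J σ x - 1 = 2 * (bumpRegression α ω i J σ x - 1 / 2) := by
        ring
      rw [e, abs_mul, abs_two]
      calc ω ^ α / (20 * d) = 2 * (ω ^ α / (40 * d)) := by field_simp; norm_num
        _ ≤ _ := by gcongr)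
    (fun k hk x hx => by
      rw [hval k hk x hx.1]
      have : 0 < x i - site h k i := sub_pos.2 hx.2
      linarith [mul_pos hc this])
    (fun k hk x hx => by
      rw [hval k hk x hx.1]
      have : 0 < site h k i - x i := sub_pos.2 hx.2
      linarith [mul_pos hc this])
    ρ (ω := ω)
    (fun k hk x hx => ((hK _ hmem).bumpModel_apply hd hω le_rfl hk hx.1).1 hx.2)
    (fun k hk x hx => ((hK _ hmem).bumpModel_apply hd hω le_rfl hk hx.1).2 hx.2)
    (T := Metric.ball (EuclideanSpace.single i (1 : ℝ)) (1 / 8)) measurableSet_ball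
    (by
      intro u hu k _ x hx
      rw [Metric.mem_ball, dist_eq_norm] at hu
      have hcmp : ∀ j, |u j - (EuclideanSpace.single i (1 : ℝ) : Feature d) j| < 1 / 8 := fun j => by
        refine lt_of_le_of_lt ?_ hu
        simpa only [PiLp.sub_apply, Real.norm_eq_abs] using
          PiLp.norm_apply_le (u - EuclideanSpace.single i (1 : ℝ)) j
      have hi := abs_lt.1 (hcmp i)
      simp only [PiLp.single_apply, if_true] at hi
      have hxi := hx i
      have hneg : x i - 2 * ω * u i - h * ((k i : ℕ) : ℝ) < 0 := by nlinarith [hxi.2]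
      refine ⟨fun j => ?_, ?_⟩
      · simp only [PiLp.sub_apply, PiLp.smul_apply, smul_eq_mul]
        by_cases hj : j = i
        · subst hj
          refine ⟨?_, ?_⟩ <;> rw [abs_of_neg hneg] <;> nlinarith [hxi.1, hxi.2]
        · have hj' := abs_lt.1 (hcmp j)
          simp only [PiLp.single_apply, hj, if_false, sub_zero] at hj'
          have hxj := hx j
          have hpos : 0 ≤ x j - 2 * ω * u j - h * ((k j : ℕ) : ℝ) := by nlinarith [hxj.1]
          refine ⟨?_, ?_⟩ <;> rw [abs_of_nonneg hpos] <;> nlinarith [hxj.1, hxj.2]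
      · change (x - (2 * ω) • u) i < site h k i
        simp only [PiLp.sub_apply, PiLp.smul_apply, smul_eq_mul, site_apply]
        linarith)
    (w := ENNReal.ofReal (((4 * M : ℝ) ^ d)⁻¹)) (fun k _ => (hQvol k).ge)
  refine ⟨_, hmem, ?_⟩
  have htop := ne_top_of_le_ne_top ENNReal.one_ne_top (excessRisk_le_one (unifCells d M ω) hm
    (fun x => (h01 x).1) (fun x => (h01 x).2) (K (bumpModel α ω i J σ)) g)
  have hreg : testError (bumpModel α ω i J σ).1 (K (bumpModel α ω i J σ)) g
      - bayesError (bumpModel α ω i J σ).1 (bumpModel α ω i J σ).2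
      = (excessRisk (unifCells d M ω) (bumpRegression α ω i J σ) (K (bumpModel α ω i J σ)) g).toReal
    := testError_sub_bayesError _ hm (fun x => (h01 x).1) (fun x => (h01 x).2) _ hg
  rw [hreg]
  have key' := ENNReal.toReal_mono htop key
  simp only [ENNReal.toReal_mul, ENNReal.toReal_natCast] at key'
  rw [ENNReal.toReal_ofReal (by positivity), ENNReal.toReal_ofReal (by positivity)] at key'
  have hρ' := ENNReal.toReal_mono (measure_ne_top _ _) hρ
  rw [ENNReal.toReal_ofReal hδ.le] at hρ'
  rw [rpow_mul_add_one hω]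
  refine le_trans ?_ key'
  calc δ / (40 * d * 4 ^ d) * (ω ^ (α * β) * ω ^ α)
      = ω ^ (α * β) / 2 * (ω ^ α / (20 * d) * ((4 ^ d)⁻¹ * δ)) := by field_simp; norm_num
    _ ≤ J.card * ((M : ℝ) ^ d)⁻¹ * (ω ^ α / (20 * d) * ((4 ^ d)⁻¹ *
          (ρ (Metric.ball (EuclideanSpace.single i (1 : ℝ)) (1 / 8))).toReal)) := by gcongr
    _ = _ := by rw [mul_pow]; ring

/-- The lower bound for perturbations that push the points near the decision boundary towards
it. -/
theorem exists_regret_ge_rate (hd : 1 ≤ d) (hα0 : 0 < α) (hα1 : α ≤ 1) (hβ : 0 < β)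
    (hαβ : α * β ≤ d) (hn : 1 ≤ n) {ω : ℝ} (hω0 : 0 ≤ ω) (hω1 : ω ≤ 1) (hg : Measurable g)
    (i : Fin d) (ρ : Measure (Feature d)) [IsProbabilityMeasure ρ] {δ : ℝ} (hδ : 0 < δ)
    (hρ : ENNReal.ofReal δ ≤ ρ (Metric.ball (EuclideanSpace.single i (1 : ℝ)) (1 / 8)))
    (K : Model d → Kernel (Feature d) (Feature d))
    (hK : ∀ p ∈ strongMarginClass d α β (modelConstants hd β), PushesTowards i ρ ω p.2 (K p)) :
    ∃ p ∈ strongMarginClass d α β (modelConstants hd β),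
      min (1 / (640 * (d : ℝ))) (δ / (40 * d * 4 ^ d)) * rate d α β n ω
        ≤ testError p.1 (K p) g - bayesError p.1 p.2 := by
  have hd' : (0 : ℝ) < d := by exact_mod_cast hd
  have hn' : (1 : ℝ) ≤ n := by exact_mod_cast hn
  have hn0 : (0 : ℝ) < n := by linarith
  have hexp : 0 < 2 * α + d := by positivity
  -- The scale at which `n * s ^ (2 * α + d) = 1`; the rate is `max ω s` to the power `α * (β + 1)`.
  set s : ℝ := (n : ℝ) ^ (-(1 / (2 * α + d))) with hs
  have hs0 : 0 < s := Real.rpow_pos_of_pos hn0 _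
  have hs1 : s ≤ 1 := Real.rpow_le_one_of_one_le_of_nonpos hn' (by
    rw [neg_nonpos]; positivity)
  have hsn : n * s ^ (2 * α + d) ≤ 1 := by
    rw [hs, ← Real.rpow_mul hn0.le, neg_mul, one_div_mul_cancel hexp.ne', Real.rpow_neg_one,
      mul_inv_cancel₀ hn0.ne']
  have hpow : 0 < α * (β + 1) := by positivity
  have hsr : (n : ℝ) ^ (-(α * (β + 1) / (2 * α + d))) = s ^ (α * (β + 1)) := by
    rw [hs, ← Real.rpow_mul hn0.le]
    congr 1
    field_simp
  rcases le_or_gt ω s with h | h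
  · obtain ⟨p, hp, hle⟩ := exists_regret_ge_of_small_sample hd hα0 hα1 hβ hαβ hs0 hs1 hsn h hg i ρ
      K hK
    refine ⟨p, hp, le_trans ?_ hle⟩
    rw [rate, hsr, max_eq_right (Real.rpow_le_rpow hω0 h hpow.le)]
    gcongr
    exact min_le_left _ _
  · obtain ⟨p, hp, hle⟩ := exists_regret_ge_of_large_perturbation hd hα0 hα1 hβ hαβ (hs0.trans h)
      hω1 hg i ρ hδ hρ K hK
    refine ⟨p, hp, le_trans ?_ hle⟩
    rw [rate, hsr, max_eq_left (Real.rpow_le_rpow hs0.le h.le hpow.le)]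
    gcongr
    exact min_le_right _ _

theorem rate_le_rate (hα0 : 0 < α) {β' : ℝ} (hβ : β' ≤ β) (hβ' : 0 < β') (hn : 1 ≤ n) {ω : ℝ}
    (hω0 : 0 ≤ ω) (hω1 : ω ≤ 1) : rate d α β n ω ≤ rate d α β' n ω := by
  have hn' : (1 : ℝ) ≤ n := by exact_mod_cast hn
  have hβ0 : 0 < β := hβ'.trans_le hβ
  refine max_le_max ?_ ?_
  -- At `ω = 0` monotonicity in the exponent could fail only at exponent zero, which positivity
  -- excludes.
  · exact Real.rpow_le_rpow_of_exponent_ge_of_imp hω0 hω1 (by gcongr)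
      fun _ h => absurd h (by positivity)
  · refine Real.rpow_le_rpow_of_exponent_le hn' ?_
    gcongr

/-- The regret under a model of a class is at most the worst-case regret over the class. -/
theorem le_worstRegret {𝒟 : Set (Model d)} (h𝒟 : ∀ p ∈ 𝒟, IsProbabilityMeasure p.1)
    {K : Model d → Kernel (Feature d) (Feature d)} (hK : ∀ p ∈ 𝒟, IsMarkovKernel (K p))
    (g : Classifier d n) {p : Model d} (hp : p ∈ 𝒟) :
    testError p.1 (K p) g - bayesError p.1 p.2 ≤ worstRegret 𝒟 K g := by
  -- A real supremum needs an upper bound to be meaningful; every regret is at most 1.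
  refine le_ciSup (f := fun p : 𝒟 => testError p.1.1 (K p.1) g - bayesError p.1.1 p.1.2)
    ⟨1, ?_⟩ ⟨p, hp⟩
  rintro _ ⟨⟨q, hq⟩, rfl⟩
  have := h𝒟 q hq
  have := hK q hq
  have h1 : testError q.1 (K q) g ≤ 1 := measureReal_le_one
  have h2 : 0 ≤ bayesError q.1 q.2 := measureReal_nonneg
  change testError q.1 (K q) g - bayesError q.1 q.2 ≤ 1
  linarith

end Minimax

end PerturbedClassification

end

/-! ### The main theorem: both perturbations and all margin exponents -/

open PerturbedClassification in
theorem theoremS4 (d : ℕ) (hd : 1 ≤ d) (α β : ℝ) (hα0 : 0 < α) (hα1 : α ≤ 1) (hβ : 0 < β) :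
    ∃ C : ℝ, 0 < C ∧ ∃ κ : Constants,
      ∀ (n : ℕ), 1 ≤ n → ∀ (ω : ℝ), 0 ≤ ω → ω ≤ 1 →
      ∀ (g : Classifier d n), Measurable g →
        (C * rate d α β n ω ≤
            worstRegret (distClass d α β) (fun _ => randomPerturbation d ω) g ∧
          ∀ K : Model d → ProbabilityTheory.Kernel (Feature d) (Feature d),
            (∀ p ∈ distClass d α β, IsAttack ω p.2 (K p)) →
            C * rate d α β n ω ≤ worstRegret (distClass d α β) K g) ∧
        (α * β ≤ d →
          C * rate d α β n ω ≤
              worstRegret (distClassWith d α β κ) (fun _ => randomPerturbation d ω) g ∧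
            ∀ K : Model d → ProbabilityTheory.Kernel (Feature d) (Feature d),
              (∀ p ∈ distClassWith d α β κ, IsAttack ω p.2 (K p)) →
              C * rate d α β n ω ≤ worstRegret (distClassWith d α β κ) K g) := by
  have hd' : (0 : ℝ) < d := by exact_mod_cast hd
  let i : Fin d := ⟨0, hd⟩
  have hunif := isProbabilityMeasure_unifUnitSphere hd
  set b : Set (Feature d) := Metric.ball (EuclideanSpace.single i (1 : ℝ)) (1 / 8)
  set δ : ℝ := (unifUnitSphere d b).toReal with hδdef
  have hδ : 0 < δ := ENNReal.toReal_pos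
    (unifUnitSphere_ball_pos (by simp) (by norm_num)).ne' (measure_ne_top _ _)
  have hδu : ENNReal.ofReal δ ≤ unifUnitSphere d b := ENNReal.ofReal_toReal_le
  -- The point mass gives the ball mass 1, so the constant of the random perturbation also serves
  -- the adversarial one.
  have hδd : ENNReal.ofReal δ ≤ Measure.dirac (EuclideanSpace.single i (1 : ℝ) : Feature d) b := by
    rw [Measure.dirac_apply_of_mem (Metric.mem_ball_self (by norm_num))]
    exact hδu.trans prob_le_one
  -- The exponent is capped at `d / α`, the largest for which active cells exist; when `α * β ≤ d`
  -- nothing changes and the constants in `κ` are those for `β` itself.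
  obtain ⟨β₀, hβ₀, hβ₀β, hαβ₀, hβ₀eq⟩ : ∃ β₀ : ℝ, 0 < β₀ ∧ β₀ ≤ β ∧ α * β₀ ≤ d ∧
      (α * β ≤ d → β₀ = β) := by
    refine ⟨min β (d / α), lt_min hβ (by positivity), min_le_left _ _, ?_, fun h => ?_⟩
    · calc α * min β (d / α) ≤ α * (d / α) := by gcongr; exact min_le_right _ _
        _ = d := by field_simp
    · exact min_eq_left ((le_div_iff₀ hα0).2 (by linarith))
  set C : ℝ := min (1 / (640 * (d : ℝ))) (δ / (40 * d * 4 ^ d))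
  have hC : 0 < C := lt_min (by positivity) (by positivity)
  refine ⟨C, hC, modelConstants hd β₀, fun n hn ω hω0 hω1 g hg => ?_⟩
  have hrate : C * rate d α β n ω ≤ C * rate d α β₀ n ω :=
    mul_le_mul_of_nonneg_left (rate_le_rate hα0 hβ₀β hβ₀ hn hω0 hω1) hC.le
  have hrand : ∀ 𝒟 : Set (Model d), (∀ p ∈ 𝒟, IsProbabilityMeasure p.1) →
      strongMarginClass d α β₀ (modelConstants hd β₀) ⊆ 𝒟 →
      C * rate d α β n ω ≤ worstRegret 𝒟 (fun _ => randomPerturbation d ω) g := by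
    intro 𝒟 h𝒟 hsub
    obtain ⟨p, hp, hle⟩ := exists_regret_ge_rate hd hα0 hα1 hβ₀ hαβ₀ hn hω0 hω1 hg i
      (unifUnitSphere d) hδ hδu (fun _ => randomPerturbation d ω)
      fun p _ => pushesTowards_randomPerturbation hd i ω p.2
    exact (hrate.trans hle).trans
      (le_worstRegret h𝒟 (fun _ _ => isMarkovKernel_randomPerturbation hd ω) g (hsub hp))
  have hatt : ∀ 𝒟 : Set (Model d), (∀ p ∈ 𝒟, IsProbabilityMeasure p.1) →
      strongMarginClass d α β₀ (modelConstants hd β₀) ⊆ 𝒟 →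
      ∀ K : Model d → ProbabilityTheory.Kernel (Feature d) (Feature d),
        (∀ p ∈ 𝒟, IsAttack ω p.2 (K p)) → C * rate d α β n ω ≤ worstRegret 𝒟 K g := by
    intro 𝒟 h𝒟 hsub K hK
    obtain ⟨p, hp, hle⟩ := exists_regret_ge_rate hd hα0 hα1 hβ₀ hαβ₀ hn hω0 hω1 hg i
      (Measure.dirac (EuclideanSpace.single i (1 : ℝ))) hδ hδd K
      fun p hp => (hK p (hsub hp)).pushesTowards i hω0
    exact (hrate.trans hle).trans (le_worstRegret h𝒟 (fun p hp => (hK p hp).1) g (hsub hp))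
  have hprob : ∀ p ∈ distClass d α β, IsProbabilityMeasure p.1 := fun p ⟨_, h⟩ =>
    h.isProbabilityMeasure
  have hsub : strongMarginClass d α β₀ (modelConstants hd β₀) ⊆ distClass d α β :=
    fun p hp => hp.2 β hβ
  refine ⟨⟨hrand _ hprob hsub, hatt _ hprob hsub⟩, fun hαβ => ?_⟩
  have hprob' : ∀ p ∈ distClassWith d α β (modelConstants hd β₀), IsProbabilityMeasure p.1 :=
    fun p h => Satisfies.isProbabilityMeasure h
  have hsub' : strongMarginClass d α β₀ (modelConstants hd β₀)
      ⊆ distClassWith d α β (modelConstants hd β₀) := fun p hp => by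
    have := hp.1
    rwa [hβ₀eq hαβ] at this ⊢
  exact ⟨hrand _ hprob' hsub', hatt _ hprob' hsub'⟩
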